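/- **Setting.** Let $\mathcal H=\mathbb C^d$. The logical register is $\mathcal H_{\rm L}=\mathcal H$, the physical register is $\mathcal H_{\rm P}=\mathcal H^{\otimes n_{\rm P}}$, and the reference frame register is $\mathcal H_{\rm R}=\bigotimes_{k=1}^{s_{\rm R}}\mathcal H_{{\rm R},k}$ with $\mathcal H_{{\rm R},k}=\mathcal H^{\otimes m}\otimes\mathcal H^{\otimes m}$. A group element $U\in{\rm SU}(d)$ acts on them as $U_{\rm L}=U$, $U_{\rm P}=U^{\otimes n_{\rm P}}$ and $U_{\rm R}=(U^{\otimes m}\otimes I)^{\otimes s_{\rm R}}$; a calligraphic $\mathcal U$ denotes the map $X\mapsto UXU^\dagger$, and ${\rm d}U$ the normalised Haar measure. The $k$-th frame space is enlarged to $\mathcal H_{{\rm R},k}\oplus\mathcal H_{{\rm err},k}$, where the finite-dimensional error space $\mathcal H_{{\rm err},k}$ carries some unitary representation of ${\rm SU}(d)$; on the enlarged register $\bigotimes_k(\mathcal H_{{\rm R},k}\oplus\mathcal H_{{\rm err},k})$, $V_{\rm R}$ denotes the resulting action. For channels (and trace non-increasing completely positive maps) put $$\epsilon_{\rm wc}(\mathcal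 A,\mathcal B)=\tfrac12\sup_\rho\|(\mathcal A\otimes\mathcal I)(\rho)-(\mathcal B\otimes\mathcal I)(\rho)\|_1,\qquad F_{\rm wc}(\mathcal A,\mathcal B)=\inf_\rho F\big((\mathcal A\otimes\mathcal I)(\rho),(\mathcal B\otimes\mathcal I)(\rho)\big),$$ over all states $\rho$ of the input and a reference system of arbitrary finite dimension, where $F(\rho,\sigma)=\big({\rm Tr}\sqrt{\rho^{1/2}\sigma\rho^{1/2}}\big)^2$. **The code.** Let $\mathcal E$ (from $\rm L$ to $\rm P$) and $\mathcal D$ (from $\rm P$ to $\rm L$) be arbitrary channels, and $\Psi$ an arbitrary state on $\mathcal H_{\rm R}$. For each $\mathsf s\subseteq\{1,\dots,s_{\rm R}\}$ let $\Xi_{\mathsf s}\ge0$ be an operator on $\bigotimes_{k\in\mathsf s}\mathcal H_{{\rm R},k}$ with $\int{\rm d}U\,\mathcal U(\Xi_{\mathsf s})\le I$ (the seed of a covariant measurement, for instance $\Xi_{\mathsf s}=|\eta_I\rangle\langle\eta_I|_{\mathsf s}$ for the optimal covariant measurement $\{|\eta_{\hat U}\rangle\langle\eta_{\hat U}|\,{\rm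 d}\hat U\}$). The error-tolerant measurement, with density $$\mathcal M_{\hat U}(X)=\sum_{\mathsf s}{\rm Tr}\big[X\,\big(\hat{\mathcal U}(\Xi_{\mathsf s})\otimes P_{{\rm err},\mathsf s^c}\big)\big],$$ discards the frames found in their error spaces and measures the others jointly; here $P_{{\rm err},\mathsf s^c}$ projects onto the error spaces of all $k\notin\mathsf s$. The covariant code is $$\mathcal E_{\rm cov}(\cdot)=\int{\rm d}U\;\mathcal U_{\rm P}\circ\mathcal E\circ\mathcal U_{\rm L}^{-1}(\cdot)\otimes\mathcal U_{\rm R}(\Psi),\qquad \mathcal D_{\rm cov}=\int{\rm d}\hat U\;\hat{\mathcal U}_{\rm L}\circ\mathcal D\circ\hat{\mathcal U}_{\rm P}^{-1}\otimes\mathcal M_{\hat U}.$$ **Lemma.** Let $\mathcal C=\sum_jp_j\,\mathcal C_{j,{\rm P}}\otimes\mathcal C_{j,{\rm R}}$ be a finite convex combination, where each $\mathcal C_{j,{\rm P}}$ is a channel on $\mathcal H_{\rm P}$ and each $\mathcal C_{j,{\rm R}}$ is a channel from $\mathcal H_{\rm R}$ to the enlarged register, so that errors may take frames to their error spaces, where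 they are detected. Suppose that $\mathcal C$ is covariant: $\mathcal C\circ(\mathcal V_{\rm P}\otimes\mathcal V_{\rm R})=(\mathcal V_{\rm P}\otimes\mathcal V_{\rm R})\circ\mathcal C$ for all $V\in{\rm SU}(d)$. Then $$\epsilon_{\rm cov}:=\sup_{V\in{\rm SU}(d)}\epsilon_{\rm wc}\big(\mathcal D_{\rm cov}\circ\mathcal C\circ(\mathcal V_{\rm P}\otimes\mathcal V_{\rm R})\circ\mathcal E_{\rm cov},\,\mathcal V_{\rm L}\big)\;\le\;9d\sum_jp_j\epsilon_j .$$ Here, with $p_j(U|I)=\mathcal M_U(\mathcal C_{j,{\rm R}}(\Psi))$ and $F_j=F_{\rm wc}\big(\int{\rm d}U\,p_j(U|I)\,\mathcal U_{\rm P}\otimes\mathcal U_{\rm L}^*,\ \mathcal I_{\rm P}\otimes\mathcal I_{\rm L}\big)$, where $U^*$ is the entrywise complex conjugate of $U$ and $\mathcal U^*_{\rm L}$ the map $X\mapsto U^*X(U^*)^\dagger$, $$\epsilon_j=\max\big\{\epsilon_{\rm wc}(\mathcal D\circ\mathcal C_{j,{\rm P}}\circ\mathcal E,\mathcal I_{\rm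 L}),\ 1-F_j\big\}\ \text{ if }F_j\ge\tfrac34,\qquad \epsilon_j=1\ \text{ otherwise.}$$ -/

import Mathlib

open MeasureTheory Matrix
open scoped ComplexOrder Kronecker

namespace CovCode

noncomputable section

/-! ### States, channels, fidelity and diamond-norm error

A finite-dimensional quantum system is given by the finite index type of an orthonormal basis. -/

/-- Linear maps from the operators on the system `ι` to the operators on the system `κ`. -/
abbrev SuperOp (ι κ : Type*) := Matrix ι ι ℂ →ₗ[ℂ] Matrix κ κ ℂ

section General

variable {ι ι' κ κ' : Type*}

/-- Density matrices. -/
def IsState [Fintype ι] (ρ : Matrix ι ι ℂ) : Prop := ρ.PosSemidef ∧ ρ.trace = 1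

/-- The tensor product `Φ ⊗ Θ` of two linear maps between operator spaces. -/
def tensorMap (Φ : SuperOp ι ι') (Θ : SuperOp κ κ') : SuperOp (ι × κ) (ι' × κ') where
  toFun X := Matrix.of fun a b =>
    Φ (Matrix.of fun i j => Θ (Matrix.of fun k l => X (i, k) (j, l)) a.2 b.2) a.1 b.1
  map_add' X Y := by
    ext a b
    rw [Matrix.add_apply]
    simp only [Matrix.of_apply]
    rw [← Matrix.add_apply, ← map_add]
    refine congrArg (fun Z => Φ Z a.1 b.1) ?_
    ext i j
    simp only [Matrix.of_apply, Matrix.add_apply]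
    rw [← Matrix.add_apply, ← map_add]
    rfl
  map_smul' c X := by
    ext a b
    rw [RingHom.id_apply, Matrix.smul_apply]
    simp only [Matrix.of_apply]
    rw [← Matrix.smul_apply, ← map_smul]
    refine congrArg (fun Z => Φ Z a.1 b.1) ?_
    ext i j
    simp only [Matrix.of_apply, Matrix.smul_apply]
    rw [← Matrix.smul_apply, ← map_smul]
    rfl

/-- `Φ ⊗ M` for a linear functional `M` on the operators of the second system. -/
def tensorFunctional (Φ : SuperOp ι ι') (M : Matrix κ κ ℂ →ₗ[ℂ] ℂ) : SuperOp (ι × κ) ι' where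
  toFun X := Φ (Matrix.of fun i j => M (Matrix.of fun k l => X (i, k) (j, l)))
  map_add' X Y := by
    rw [← map_add]
    congr 1
    ext i j
    simp only [Matrix.of_apply, Matrix.add_apply]
    rw [← map_add]
    rfl
  map_smul' c X := by
    rw [RingHom.id_apply, ← map_smul]
    congr 1
    ext i j
    simp only [Matrix.of_apply, Matrix.smul_apply]
    rw [← map_smul]
    rfl

/-- `X ↦ Φ(X) ⊗ ρ` for a fixed operator `ρ` on the second system. -/
def appendState (Φ : SuperOp ι ι') (ρ : Matrix κ κ ℂ) : SuperOp ι (ι' × κ) where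
  toFun X := Φ X ⊗ₖ ρ
  map_add' X Y := by rw [map_add, Matrix.add_kronecker]
  map_smul' c X := by rw [map_smul, Matrix.smul_kronecker, RingHom.id_apply]

/-- The map `X ↦ A X A†`. -/
def conjMap [Fintype ι] (A : Matrix ι' ι ℂ) : SuperOp ι ι' where
  toFun X := A * X * Aᴴ
  map_add' X Y := by rw [Matrix.mul_add, Matrix.add_mul]
  map_smul' c X := by rw [Matrix.mul_smul, Matrix.smul_mul, RingHom.id_apply]

/-- Quantum channels: completely positive trace-preserving linear maps. -/
def IsChannel [Fintype ι] [Fintype κ] (Φ : SuperOp ι κ) : Prop :=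
  (∀ (n : ℕ) (X : Matrix (ι × Fin n) (ι × Fin n) ℂ), X.PosSemidef →
      (tensorMap Φ (LinearMap.id : SuperOp (Fin n) (Fin n)) X).PosSemidef) ∧
    ∀ X, (Φ X).trace = X.trace

/-- The square root of a positive semidefinite matrix. -/
def msqrt [Fintype ι] [DecidableEq ι] (A : Matrix ι ι ℂ) : Matrix ι ι ℂ := cfc Real.sqrt A

/-- The trace norm `Tr √(X† X)`. -/
def traceNorm [Fintype ι] [DecidableEq ι] (X : Matrix ι ι ℂ) : ℝ := (msqrt (Xᴴ * X)).trace.re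

/-- The Uhlmann fidelity `(Tr √(√ρ σ √ρ))²`. -/
def fidelity [Fintype ι] [DecidableEq ι] (ρ σ : Matrix ι ι ℂ) : ℝ :=
  (msqrt (msqrt ρ * σ * msqrt ρ)).trace.re ^ 2

/-- The diamond-norm error: half the supremum, over all states `ρ` of the input and a reference
system of arbitrary finite dimension `k`, of `‖(Φ ⊗ id)(ρ) - (Θ ⊗ id)(ρ)‖₁`. -/
def epsWc [Fintype ι] [Fintype κ] [DecidableEq κ] (Φ Θ : SuperOp ι κ) : ℝ :=
  (1 / 2) * sSup {x : ℝ | ∃ (k : ℕ) (ρ : Matrix (ι × Fin k) (ι × Fin k) ℂ), IsState ρ ∧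
    x = traceNorm (tensorMap Φ (LinearMap.id : SuperOp (Fin k) (Fin k)) ρ
      - tensorMap Θ (LinearMap.id : SuperOp (Fin k) (Fin k)) ρ)}

/-- The worst-case input fidelity: the infimum of the fidelity of the outputs over all states of
the input and a reference system of arbitrary finite dimension `k`. -/
def Fwc [Fintype ι] [Fintype κ] [DecidableEq κ] (Φ Θ : SuperOp ι κ) : ℝ :=
  sInf {x : ℝ | ∃ (k : ℕ) (ρ : Matrix (ι × Fin k) (ι × Fin k) ℂ), IsState ρ ∧
    x = fidelity (tensorMap Φ (LinearMap.id : SuperOp (Fin k) (Fin k)) ρ)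
      (tensorMap Θ (LinearMap.id : SuperOp (Fin k) (Fin k)) ρ)}

/-- The tensor product `⨂ₖ Mₖ` of a finite family of matrices. -/
def piKron {K : Type*} [Fintype K] {β γ : K → Type*} (M : ∀ k, Matrix (β k) (γ k) ℂ) :
    Matrix (∀ k, β k) (∀ k, γ k) ℂ :=
  Matrix.of fun x y => ∏ k, M k (x k) (y k)

end General

/-! ### The group `SU(d)` and its Haar integral -/

/-- The special unitary group `SU(d)`. -/
abbrev SU (d : ℕ) := Matrix.specialUnitaryGroup (Fin d) ℂ

section Haar

variable {d : ℕ}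

instance : ContinuousInv (SU d) where
  continuous_inv := continuous_induced_rng.mpr continuous_subtype_val.star

instance : IsTopologicalGroup (SU d) where

instance : CompactSpace (SU d) := by
  have hc : IsCompact (Set.pi Set.univ fun _ : Fin d =>
      Set.pi Set.univ fun _ : Fin d => Metric.closedBall (0 : ℂ) 1) :=
    isCompact_univ_pi fun _ => isCompact_univ_pi fun _ => isCompact_closedBall _ _
  have hcl : IsClosed (Matrix.specialUnitaryGroup (Fin d) ℂ : Set (Matrix (Fin d) (Fin d) ℂ)) := by
    have h : (Matrix.specialUnitaryGroup (Fin d) ℂ : Set (Matrix (Fin d) (Fin d) ℂ))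
        = (unitary (Matrix (Fin d) (Fin d) ℂ) : Set _) ∩ {A | A.det = 1} := by
      ext A; exact Iff.rfl
    rw [h]
    exact isClosed_unitary.inter (isClosed_eq (Continuous.matrix_det continuous_id)
      continuous_const)
  refine isCompact_iff_compactSpace.mp (hc.of_isClosed_subset hcl ?_)
  intro A hA i _ j _
  simpa using entry_norm_bound_of_unitary (Matrix.specialUnitaryGroup_le_unitaryGroup hA) i j

instance : MeasurableSpace (SU d) := borel _

instance : BorelSpace (SU d) := ⟨rfl⟩

/-- The normalised Haar measure of `SU(d)`. -/
def haarSU (d : ℕ) : Measure (SU d) := Measure.haarMeasure ⊤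

/-- The entrywise integral `∫ dU F(U)` of a matrix-valued function. -/
def haarMat {ι : Type*} (F : SU d → Matrix ι ι ℂ) : Matrix ι ι ℂ :=
  Matrix.of fun a b => ∫ U, F U a b ∂haarSU d

/-- The integral `∫ dU F(U)` of a family of linear maps between operator spaces: the linear map
sending each matrix unit `E` to the entrywise integral `∫ dU F(U)(E)`. -/
def haarMap {ι κ : Type*} [Fintype ι] [DecidableEq ι] (F : SU d → SuperOp ι κ) : SuperOp ι κ :=
  ∑ i, ∑ j, (Matrix.entryLinearMap ℂ ℂ i j).smulRight
    (haarMat fun U => F U (Matrix.single i j 1))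

end Haar

/-! ### The registers and the actions of `SU(d)` on them -/

/-- The logical register: one qudit. -/
abbrev Logical (d : ℕ) := Fin d

/-- The register of `n` qudits. -/
abbrev Qudits (d n : ℕ) := Fin n → Fin d

/-- One reference frame: `m` qudits together with `m` further qudits as their reference. -/
abbrev Frame (d m : ℕ) := Qudits d m × Qudits d m

/-- The joint system of the reference frames with labels in `K`. -/
abbrev Frames (d m : ℕ) (K : Type*) := K → Frame d m

/-- The reference frame register after the noise: the space of the `k`-th frame is enlarged by the
orthogonal error space with basis `Er k`. -/
abbrev NoisyFrames (d m : ℕ) {sR : ℕ} (Er : Fin sR → Type*) := ∀ k, Frame d m ⊕ Er k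

section Actions

variable {d m sR : ℕ} {Er : Fin sR → Type*}

instance : DecidableEq (Frame d m) := inferInstance

instance [∀ k, DecidableEq (Er k)] : DecidableEq (NoisyFrames d m Er) := inferInstance

/-- `U^{⊗ n}` on `n` qudits. -/
def actQ (n : ℕ) (U : SU d) : Matrix (Qudits d n) (Qudits d n) ℂ :=
  piKron fun _ => (U : Matrix (Fin d) (Fin d) ℂ)

/-- `U^{⊗ m} ⊗ I` on one reference frame. -/
def actFrame (m : ℕ) (U : SU d) : Matrix (Frame d m) (Frame d m) ℂ :=
  actQ m U ⊗ₖ (1 : Matrix (Qudits d m) (Qudits d m) ℂ)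

/-- The action on the reference frames with labels in `K`. -/
def actFrames (m : ℕ) (K : Type*) [Fintype K] (U : SU d) :
    Matrix (Frames d m K) (Frames d m K) ℂ :=
  piKron fun _ => actFrame m U

/-- The action on the enlarged frames, where `W k` is the representation on the error space of
the `k`-th frame. -/
def actNoisy [∀ k, Fintype (Er k)] [∀ k, DecidableEq (Er k)]
    (W : ∀ k, SU d →* Matrix.unitaryGroup (Er k) ℂ) (U : SU d) :
    Matrix (NoisyFrames d m Er) (NoisyFrames d m Er) ℂ :=
  piKron fun k => Matrix.fromBlocks (actFrame m U) 0 0 (W k U : Matrix (Er k) (Er k) ℂ)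

/-! ### The error-tolerant covariant measurement -/

/-- The basis vector of the enlarged register in which the frames in `s` are in their original
spaces, at position `a`, and the other frames are in their error spaces, at position `e`. -/
def place (s : Finset (Fin sR)) (e : ∀ k : {k // k ∉ s}, Er k)
    (a : Frames d m {k // k ∈ s}) : NoisyFrames d m Er :=
  fun k => if h : k ∈ s then Sum.inl (a ⟨k, h⟩) else Sum.inr (e ⟨k, h⟩)

/-- A covariant measurement on the frames with labels in `K`, with (unnormalised) effect density
`U Ξ U†` with respect to `dU`: positive, and of total weight at most one. The weight may
be a proper projection, as for a measurement on a subspace only. -/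
def IsCovariantPOVM {K : Type*} [Fintype K] [DecidableEq K]
    (Ξ : Matrix (Frames d m K) (Frames d m K) ℂ) : Prop :=
  Ξ.PosSemidef ∧
    ((1 : Matrix (Frames d m K) (Frames d m K) ℂ)
      - haarMat fun U : SU d => conjMap (actFrames m K U) Ξ).PosSemidef

/-- The outcome density
`M_U(X) = ∑_{s} Tr[X ((U Ξₛ U†)_s ⊗ P_{err, sᶜ})]`
of the error-tolerant measurement: the frames which have gone to their error spaces are
discarded, and the remaining ones, with labels in `s`, are measured jointly. -/
def errTolMeas [∀ k, Fintype (Er k)]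
    (Ξ : ∀ s : Finset (Fin sR), Matrix (Frames d m {k // k ∈ s}) (Frames d m {k // k ∈ s}) ℂ)
    (U : SU d) : Matrix (NoisyFrames d m Er) (NoisyFrames d m Er) ℂ →ₗ[ℂ] ℂ where
  toFun X := ∑ s : Finset (Fin sR), ∑ e : (∀ k : {k // k ∉ s}, Er k),
    (X.submatrix (place s e) (place s e) * conjMap (actFrames m _ U) (Ξ s)).trace
  map_add' X Y := by
    simp only [Matrix.submatrix_add, Pi.add_apply, Matrix.add_mul, Matrix.trace_add,
      Finset.sum_add_distrib]
  map_smul' c X := by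
    simp only [Matrix.submatrix_smul, Pi.smul_apply, Matrix.smul_mul, Matrix.trace_smul,
      Finset.smul_sum, RingHom.id_apply]

end Actions

/-! ### The covariant code -/

section Code

variable {d nP m sR : ℕ} {Er : Fin sR → Type*}

/-- The covariant encoder `∫ dU (U_P ∘ E ∘ U_L⁻¹) ⊗ U_R(Ψ)`. -/
def encCov (E : SuperOp (Logical d) (Qudits d nP))
    (Ψ : Matrix (Frames d m (Fin sR)) (Frames d m (Fin sR)) ℂ) :
    SuperOp (Logical d) (Qudits d nP × Frames d m (Fin sR)) :=
  haarMap fun U : SU d =>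
    appendState
      (conjMap (actQ nP U) ∘ₗ E ∘ₗ conjMap ((U⁻¹ : SU d) : Matrix (Fin d) (Fin d) ℂ))
      (conjMap (actFrames m (Fin sR) U) Ψ)

variable [∀ k, Fintype (Er k)] [∀ k, DecidableEq (Er k)]

/-- The covariant decoder `∫ dU (U_L ∘ D ∘ U_P⁻¹) ⊗ M_U`. -/
def decCov (D : SuperOp (Qudits d nP) (Logical d))
    (Ξ : ∀ s : Finset (Fin sR), Matrix (Frames d m {k // k ∈ s}) (Frames d m {k // k ∈ s}) ℂ) :
    SuperOp (Qudits d nP × NoisyFrames d m Er) (Logical d) :=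
  haarMap fun U : SU d =>
    tensorFunctional
      (conjMap (U : Matrix (Fin d) (Fin d) ℂ) ∘ₗ D ∘ₗ conjMap (actQ nP U⁻¹))
      (errTolMeas Ξ U)

/-- The noise `∑ⱼ pⱼ C_{j,P} ⊗ C_{j,R}`. -/
def noise {J : Type*} [Fintype J] (p : J → ℝ)
    (CP : J → SuperOp (Qudits d nP) (Qudits d nP))
    (CR : J → SuperOp (Frames d m (Fin sR)) (NoisyFrames d m Er)) :
    SuperOp (Qudits d nP × Frames d m (Fin sR)) (Qudits d nP × NoisyFrames d m Er) :=
  ∑ j, (p j : ℂ) • tensorMap (CP j) (CR j)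

/-- Covariance `C ∘ (V_P ⊗ V_R) = (V_P ⊗ V_R) ∘ C` of the noise, where on the output side `V_R`
acts on the enlarged register. -/
def IsCovariantNoise (W : ∀ k, SU d →* Matrix.unitaryGroup (Er k) ℂ)
    (C : SuperOp (Qudits d nP × Frames d m (Fin sR)) (Qudits d nP × NoisyFrames d m Er)) :
    Prop :=
  ∀ V : SU d, C ∘ₗ conjMap (actQ nP V ⊗ₖ actFrames m (Fin sR) V)
    = conjMap (actQ nP V ⊗ₖ actNoisy W V) ∘ₗ C

/-- The error of the covariant code: the supremum over `V` of the diamond-norm error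
`ε_wc(D_cov ∘ C ∘ (V_P ⊗ V_R) ∘ E_cov, V_L)`. -/
def epsCov (E : SuperOp (Logical d) (Qudits d nP)) (D : SuperOp (Qudits d nP) (Logical d))
    (Ψ : Matrix (Frames d m (Fin sR)) (Frames d m (Fin sR)) ℂ)
    (Ξ : ∀ s : Finset (Fin sR), Matrix (Frames d m {k // k ∈ s}) (Frames d m {k // k ∈ s}) ℂ)
    (C : SuperOp (Qudits d nP × Frames d m (Fin sR)) (Qudits d nP × NoisyFrames d m Er)) : ℝ :=
  ⨆ V : SU d, epsWc
    (decCov D Ξ ∘ₗ C ∘ₗ conjMap (actQ nP V ⊗ₖ actFrames m (Fin sR) V) ∘ₗ encCov E Ψ)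
    (conjMap (V : Matrix (Fin d) (Fin d) ℂ))

/-- The outcome density `p_j(U|I) = M_U(C_{j,R}(Ψ))`. -/
def outcomeDensity (Ψ : Matrix (Frames d m (Fin sR)) (Frames d m (Fin sR)) ℂ)
    (Ξ : ∀ s : Finset (Fin sR), Matrix (Frames d m {k // k ∈ s}) (Frames d m {k // k ∈ s}) ℂ)
    (CR : SuperOp (Frames d m (Fin sR)) (NoisyFrames d m Er)) (U : SU d) : ℂ :=
  errTolMeas Ξ U (CR Ψ)

/-- The worst-case fidelity of `∫ dU p(U) U_P ⊗ U_L^*` and the identity, where `U^*` is the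
entrywise complex conjugate. -/
def frameFidelity (nP : ℕ) (q : SU d → ℂ) : ℝ :=
  Fwc
    (haarMap fun U : SU d =>
      q U • conjMap (actQ nP U ⊗ₖ (U : Matrix (Fin d) (Fin d) ℂ).map star))
    (LinearMap.id : SuperOp (Qudits d nP × Logical d) (Qudits d nP × Logical d))

/-- The error `ε_j` of one product noise term `C_P ⊗ C_R`. -/
def epsTerm (E : SuperOp (Logical d) (Qudits d nP)) (D : SuperOp (Qudits d nP) (Logical d))
    (Ψ : Matrix (Frames d m (Fin sR)) (Frames d m (Fin sR)) ℂ)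
    (Ξ : ∀ s : Finset (Fin sR), Matrix (Frames d m {k // k ∈ s}) (Frames d m {k // k ∈ s}) ℂ)
    (CP : SuperOp (Qudits d nP) (Qudits d nP))
    (CR : SuperOp (Frames d m (Fin sR)) (NoisyFrames d m Er)) : ℝ :=
  open scoped Classical in
  if 3 / 4 ≤ frameFidelity nP (outcomeDensity Ψ Ξ CR) then
    max (epsWc (D ∘ₗ CP ∘ₗ E) LinearMap.id)
      (1 - frameFidelity nP (outcomeDensity Ψ Ξ CR))
  else 1

end Code

end

end CovCode

/-! Only the mixture of noise terms is covariant, not each term, so covariance has to be used before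
the mixture is split. Covariance of the noise and of the error-tolerant measurement lets the group
element drawn by the encoder, multiplied by `V`, pass through the noise and come out on the left of
the decoder. What is left is `V_L` composed with the twirl `∫ dU U ∘ S ∘ U⁻¹` of `S = ∑ⱼ pⱼ Rⱼ`,
where `Rⱼ` is the noisy code `D ∘ C_{j,P} ∘ E` with the decoder rotated by a random `U` of density
`p_j(U|I)` (`decCov_comp_noise_comp_encCov`).

A twirl improves a map towards the identity: if `f` is the entanglement fidelity of a completely
positive `Φ`, then the twirl of `Φ` minus `f · id` is again completely positive
(`posSemidef_twirl_sub`). This is positivity of a variance: the rotated Kraus operators `U K U†`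
have mean `(tr K / d) · 1` by Schur's lemma, and the squared moduli of these scalars add up to `f`.
Hence the twirled mixture differs from the identity by a positive part and a negative part, each of
trace at most `∑ⱼ pⱼ (1 - fⱼ)`, and this bounds the diamond-norm error
(`epsWc_conjMap_comp_twirl_le`).

It remains to bound `1 - fⱼ` (`one_sub_entFid_rotatedCode_le`). Purify half of a maximally entangled
state sent through `C_{j,P} ∘ E` to a unit vector `ψ`, with the Kraus index as environment. Decoding
and comparing with the maximally entangled state is a contraction `L` on such vectors, and `‖L ψ‖²`
is the entanglement fidelity of the unrotated code. Rotating the decoder by `U` replaces `ψ` by `ψ_U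
= (U_P ⊗ U^* ⊗ I)† ψ`, and the average of `|⟨ψ, ψ_U⟩|²` is the fidelity of the frame channel on the
input `ψ`, so at least `F_j`. The contraction inequality `one_sub_norm_sq_le` combines both into `1
- fⱼ ≤ 4 ε_wc + 2 (1 - F_j) ≤ 6 εⱼ`. When `F_j < 3/4` the bound `1 - fⱼ ≤ 1` is enough. Since `6 ≤ 9
d` for `d ≥ 1`, the claim follows with room to spare. -/

namespace CovCode

noncomputable section

/-! ### Linear maps between operator spaces -/

section SuperOperators

variable {ι ι' ι'' κ κ' : Type*}

/-- Complete positivity. -/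
def IsCP (Φ : SuperOp ι κ) : Prop :=
  ∀ (n : ℕ) (X : Matrix (ι × Fin n) (ι × Fin n) ℂ), X.PosSemidef →
    (tensorMap Φ (LinearMap.id : SuperOp (Fin n) (Fin n)) X).PosSemidef

theorem IsChannel.isCP [Fintype ι] [Fintype κ] {Φ : SuperOp ι κ} (h : IsChannel Φ) : IsCP Φ := h.1

/-- The block of an operator on `ι × κ` with labels `k` and `l` in the second system. -/
def block (X : Matrix (ι × κ) (ι × κ) ℂ) (k l : κ) : Matrix ι ι ℂ :=
  Matrix.of fun i j => X (i, k) (j, l)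

theorem tensorMap_id_apply (Φ : SuperOp ι ι') (X : Matrix (ι × κ) (ι × κ) ℂ) (a b : ι' × κ) :
    tensorMap Φ (LinearMap.id : SuperOp κ κ) X a b = Φ (block X a.2 b.2) a.1 b.1 := rfl

theorem tensorMap_kronecker (Φ : SuperOp ι ι') (Θ : SuperOp κ κ') (A : Matrix ι ι ℂ)
    (B : Matrix κ κ ℂ) : tensorMap Φ Θ (A ⊗ₖ B) = Φ A ⊗ₖ Θ B := by
  ext ⟨i, k⟩ ⟨j, l⟩
  have h1 : ∀ i' j' : ι, (Matrix.of fun k l => (A ⊗ₖ B) (i', k) (j', l)) = A i' j' • B := by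
    intro i' j'; ext; simp [kroneckerMap_apply]
  have h2 : (Matrix.of fun i' j' : ι => Θ (A i' j' • B) k l) = Θ B k l • A := by
    ext; simp [mul_comm]
  change Φ (Matrix.of fun i' j' => Θ (Matrix.of fun k l => (A ⊗ₖ B) (i', k) (j', l)) k l) i j = _
  rw [funext₂ fun i' j' => congrArg (fun Z => Θ Z k l) (h1 i' j'), h2, map_smul]
  simp [mul_comm]

theorem tensorFunctional_kronecker (Φ : SuperOp ι ι') (M : Matrix κ κ ℂ →ₗ[ℂ] ℂ)
    (A : Matrix ι ι ℂ) (B : Matrix κ κ ℂ) : tensorFunctional Φ M (A ⊗ₖ B) = M B • Φ A := by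
  have h1 : ∀ i' j' : ι, (Matrix.of fun k l => (A ⊗ₖ B) (i', k) (j', l)) = A i' j' • B := by
    intro i' j'; ext; simp [kroneckerMap_apply]
  have h2 : (Matrix.of fun i' j' : ι => M (A i' j' • B)) = M B • A := by
    ext; simp [mul_comm]
  change Φ (Matrix.of fun i' j' => M (Matrix.of fun k l => (A ⊗ₖ B) (i', k) (j', l))) = _
  rw [funext₂ fun i' j' => congrArg M (h1 i' j'), h2, map_smul]

theorem tensorMap_comp_id (Φ : SuperOp ι' ι'') (Θ : SuperOp ι ι')
    (X : Matrix (ι × κ) (ι × κ) ℂ) :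
    tensorMap (Φ ∘ₗ Θ) (LinearMap.id : SuperOp κ κ) X
      = tensorMap Φ (LinearMap.id : SuperOp κ κ) (tensorMap Θ (LinearMap.id : SuperOp κ κ) X) := by
  ext a b; rfl

theorem tensorMap_id_id (X : Matrix (ι × κ) (ι × κ) ℂ) :
    tensorMap (LinearMap.id : SuperOp ι ι) (LinearMap.id : SuperOp κ κ) X = X := by
  ext a b; rfl

theorem tensorMap_sum_id {J : Type*} (s : Finset J) (Φ : J → SuperOp ι ι')
    (X : Matrix (ι × κ) (ι × κ) ℂ) :
    tensorMap (∑ j ∈ s, Φ j) (LinearMap.id : SuperOp κ κ) X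
      = ∑ j ∈ s, tensorMap (Φ j) (LinearMap.id : SuperOp κ κ) X := by
  ext a b
  simp [tensorMap_id_apply, Matrix.sum_apply]

theorem tensorMap_smul_id (c : ℂ) (Φ : SuperOp ι ι') (X : Matrix (ι × κ) (ι × κ) ℂ) :
    tensorMap (c • Φ) (LinearMap.id : SuperOp κ κ) X
      = c • tensorMap Φ (LinearMap.id : SuperOp κ κ) X := by
  ext a b; rfl

theorem conjMap_apply [Fintype ι] (A : Matrix ι' ι ℂ) (X : Matrix ι ι ℂ) :
    conjMap A X = A * X * Aᴴ := rfl

theorem conjMap_comp [Fintype ι] [Fintype ι'] (A : Matrix ι'' ι' ℂ) (B : Matrix ι' ι ℂ) :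
    conjMap A ∘ₗ conjMap B = conjMap (A * B) := by
  ext1 X; simp [conjMap_apply, Matrix.mul_assoc]

theorem conjMap_posSemidef [Fintype ι] [Fintype ι'] (A : Matrix ι' ι ℂ) {X : Matrix ι ι ℂ}
    (hX : X.PosSemidef) : (conjMap A X).PosSemidef :=
  hX.mul_mul_conjTranspose_same A

theorem conjMap_kronecker [Fintype ι] [Fintype κ] (A : Matrix ι' ι ℂ) (B : Matrix κ' κ ℂ)
    (X : Matrix ι ι ℂ) (Y : Matrix κ κ ℂ) :
    conjMap (A ⊗ₖ B) (X ⊗ₖ Y) = conjMap A X ⊗ₖ conjMap B Y := by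
  simp [conjMap_apply, Matrix.mul_kronecker_mul, Matrix.conjTranspose_kronecker]

theorem conjMap_trace [Fintype ι] [Fintype ι'] [DecidableEq ι] {A : Matrix ι' ι ℂ}
    (hA : Aᴴ * A = 1) (X : Matrix ι ι ℂ) : (conjMap A X).trace = X.trace := by
  rw [conjMap_apply, Matrix.trace_mul_comm, ← Matrix.mul_assoc, hA, Matrix.one_mul]

theorem tensorMap_conjMap_id [Fintype ι] [Fintype κ] [DecidableEq κ] (A : Matrix ι' ι ℂ)
    (X : Matrix (ι × κ) (ι × κ) ℂ) :
    tensorMap (conjMap A) (LinearMap.id : SuperOp κ κ) X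
      = conjMap (A ⊗ₖ (1 : Matrix κ κ ℂ)) X := by
  ext ⟨i, k⟩ ⟨j, l⟩
  simp only [tensorMap_id_apply, conjMap_apply, Matrix.mul_apply, block, Matrix.of_apply,
    conjTranspose_apply, kroneckerMap_apply, Fintype.sum_prod_type, Matrix.one_apply]
  simp [Finset.sum_mul, apply_ite (starRingEnd ℂ)]

theorem trace_tensorMap_id [Fintype ι] [Fintype ι'] [Fintype κ] (Φ : SuperOp ι ι')
    (X : Matrix (ι × κ) (ι × κ) ℂ) :
    (tensorMap Φ (LinearMap.id : SuperOp κ κ) X).trace = ∑ k, (Φ (block X k k)).trace := by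
  simp only [Matrix.trace, Fintype.sum_prod_type, Matrix.diag]
  rw [Finset.sum_comm]
  rfl

theorem trace_eq_sum_block [Fintype ι] [Fintype κ] (X : Matrix (ι × κ) (ι × κ) ℂ) :
    X.trace = ∑ k, (block X k k).trace := by
  simp only [Matrix.trace, Fintype.sum_prod_type, Matrix.diag]
  rw [Finset.sum_comm]
  rfl

theorem IsCP.comp {Φ : SuperOp ι' ι''} {Θ : SuperOp ι ι'} (hΦ : IsCP Φ) (hΘ : IsCP Θ) :
    IsCP (Φ ∘ₗ Θ) := fun n X hX => by
  rw [tensorMap_comp_id]; exact hΦ n _ (hΘ n X hX)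

theorem isCP_conjMap [Fintype ι] [Fintype ι'] (A : Matrix ι' ι ℂ) : IsCP (conjMap A) :=
  fun n X hX => by rw [tensorMap_conjMap_id]; exact conjMap_posSemidef _ hX

theorem superOp_apply_eq_sum [Fintype ι] [DecidableEq ι] {V : Type*} [AddCommGroup V] [Module ℂ V]
    (Φ : Matrix ι ι ℂ →ₗ[ℂ] V) (X : Matrix ι ι ℂ) :
    Φ X = ∑ i, ∑ j, X i j • Φ (Matrix.single i j 1) := by
  conv_lhs => rw [Matrix.matrix_eq_sum_single X]
  simp only [map_sum]
  refine Finset.sum_congr rfl fun i _ => Finset.sum_congr rfl fun j _ => ?_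
  rw [← map_smul, Matrix.smul_single, smul_eq_mul, mul_one]

open scoped MatrixOrder in
theorem exists_eq_conjTranspose_mul_self [Fintype ι] {A : Matrix ι ι ℂ} (hA : A.PosSemidef) :
    ∃ B : Matrix ι ι ℂ, A = Bᴴ * B := by
  classical
  exact CStarAlgebra.nonneg_iff_eq_star_mul_self.mp hA.nonneg

/-- A completely positive map has a Kraus decomposition. -/
theorem IsCP.exists_kraus [Fintype ι] [DecidableEq ι] [Fintype κ] {Φ : SuperOp ι κ}
    (h : IsCP Φ) : ∃ (r : ℕ) (K : Fin r → Matrix κ ι ℂ), Φ = ∑ c, conjMap (K c) := by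
  classical
  let e := Fintype.equivFin ι
  -- Factor the Choi matrix as `Bᴴ * B`; each row of `B`, conjugated and reshaped, is a Kraus
  -- operator. The reference copy of `ι` is a `Fin n` because complete positivity is stated with
  -- such references.
  let ω : ι × Fin (Fintype.card ι) → ℂ := fun x => if e x.1 = x.2 then 1 else 0
  have hJ := h _ _ (Matrix.posSemidef_vecMulVec_self_star ω)
  obtain ⟨B, hB⟩ := exists_eq_conjTranspose_mul_self hJ
  let e' := Fintype.equivFin (κ × Fin (Fintype.card ι))
  refine ⟨_, fun c => Matrix.of fun k i => star (B (e'.symm c) (k, e i)), ?_⟩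
  have key : ∀ (i j : ι) (k l : κ), Φ (Matrix.single i j 1) k l
      = ∑ c, star (B c (k, e i)) * B c (l, e j) := by
    intro i j k l
    have := congrFun (congrFun hB (k, e i)) (l, e j)
    rw [tensorMap_id_apply] at this
    rw [Matrix.mul_apply] at this
    simp only [conjTranspose_apply] at this
    rw [← this]
    refine congrArg (fun Z => Φ Z k l) ?_
    ext a b
    simp [block, vecMulVec_apply, ω, Matrix.single_apply, eq_comm (a := a), eq_comm (a := b),
      ite_and]
    try split_ifs <;> simp
  apply LinearMap.ext
  intro X
  ext k l
  rw [superOp_apply_eq_sum Φ X, LinearMap.sum_apply]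
  simp only [Matrix.sum_apply, Matrix.smul_apply, key, conjMap_apply, Matrix.mul_apply,
    conjTranspose_apply, Matrix.of_apply, star_star]
  rw [Equiv.sum_comp e'.symm (fun c => ∑ j, (∑ i, star (B c (k, e i)) * X i j) * B c (l, e j))]
  simp only [Finset.sum_mul, smul_eq_mul]
  simp only [Finset.sum_comm (s := (Finset.univ : Finset (κ × Fin (Fintype.card ι))))]
  rw [Finset.sum_comm]
  refine Finset.sum_congr rfl fun i _ => Finset.sum_congr rfl fun j _ => ?_
  rw [Finset.mul_sum]
  exact Finset.sum_congr rfl fun c _ => by ring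

theorem trace_mul_nonneg [Fintype ι] {A B : Matrix ι ι ℂ} (hA : A.PosSemidef) (hB : B.PosSemidef) :
    0 ≤ (A * B).trace := by
  obtain ⟨C, rfl⟩ := exists_eq_conjTranspose_mul_self hA
  rw [Matrix.mul_assoc, Matrix.trace_mul_comm]
  exact (hB.mul_mul_conjTranspose_same C).trace_nonneg

theorem dotProduct_star_self_eq [Fintype ι] (χ : ι → ℂ) :
    star χ ⬝ᵥ χ = ((∑ i, ‖χ i‖ ^ 2 : ℝ) : ℂ) := by
  simp only [dotProduct, Pi.star_apply, RCLike.star_def, Complex.conj_mul']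
  push_cast; rfl

theorem trace_tensorMap_id_of_isChannel [Fintype ι] [Fintype ι'] [Fintype κ] {Φ : SuperOp ι' κ}
    (hΦ : ∀ X, (Φ X).trace = X.trace) (X : Matrix (ι' × ι) (ι' × ι) ℂ) :
    (tensorMap Φ (LinearMap.id : SuperOp ι ι) X).trace = X.trace := by
  rw [trace_tensorMap_id, trace_eq_sum_block]
  exact Finset.sum_congr rfl fun k _ => hΦ _

end SuperOperators

/-! ### Trace norm and fidelity -/

section TraceNorm

variable {ι : Type*} [Fintype ι] [DecidableEq ι]

/-- The absolute value of a Hermitian matrix. -/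
theorem msqrt_conjTranspose_mul_self {A : Matrix ι ι ℂ} (hA : A.IsHermitian) :
    msqrt (Aᴴ * A) = cfc (fun x : ℝ => |x|) A := by
  have h1 : Aᴴ * A = cfc (fun x : ℝ => x * x) A := by
    rw [cfc_mul (fun x : ℝ => x) (fun x : ℝ => x) A, cfc_id' ℝ A, hA.eq]
  rw [h1, msqrt, ← cfc_comp' Real.sqrt (fun x : ℝ => x * x) A]
  simp only [Real.sqrt_mul_self_eq_abs]

theorem traceNorm_of_isHermitian {A : Matrix ι ι ℂ} (hA : A.IsHermitian) :
    traceNorm A = (cfc (fun x : ℝ => |x|) A).trace.re := by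
  rw [traceNorm, msqrt_conjTranspose_mul_self hA]

open scoped MatrixOrder in
theorem posSemidef_cfc {f : ℝ → ℝ} {A : Matrix ι ι ℂ} (hf : ∀ x ∈ spectrum ℝ A, 0 ≤ f x) :
    (cfc f A).PosSemidef := (cfc_nonneg hf).posSemidef

open scoped MatrixOrder in
theorem spectrum_nonneg_of_posSemidef {A : Matrix ι ι ℂ} (hA : A.PosSemidef) :
    ∀ x ∈ spectrum ℝ A, 0 ≤ x := fun _ hx => spectrum_nonneg_of_nonneg hA.nonneg hx

/-- With `S` the sign of `A - B`, the trace norm is `Tr S (A - B)`, and `-1 ≤ S ≤ 1`. -/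
theorem traceNorm_sub_le {A B : Matrix ι ι ℂ} (hA : A.PosSemidef) (hB : B.PosSemidef) :
    traceNorm (A - B) ≤ A.trace.re + B.trace.re := by
  set Δ := A - B with hΔ
  have hH : Δ.IsHermitian := hA.1.sub hB.1
  -- The sign function is discontinuous, but every function is continuous on the finite spectrum.
  have hc : ∀ f : ℝ → ℝ, ContinuousOn f (spectrum ℝ Δ) := fun f =>
    (Matrix.finite_real_spectrum (A := Δ)).continuousOn f
  set S := cfc (fun x : ℝ => (SignType.sign x : ℝ)) Δ with hS
  have h1 : cfc (fun x : ℝ => |x|) Δ = S * Δ := by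
    rw [hS]
    have := cfc_mul (fun x : ℝ => (SignType.sign x : ℝ)) (fun x : ℝ => x) Δ (hc _) (hc _)
    rw [cfc_id' ℝ Δ (show IsSelfAdjoint Δ from hH)] at this
    rw [← this]
    simp only [sign_mul_self]
  have h1S : (1 - S).PosSemidef := by
    have : 1 - S = cfc (fun x : ℝ => 1 - (SignType.sign x : ℝ)) Δ := by
      rw [cfc_sub (fun _ : ℝ => (1 : ℝ)) _ Δ (hc _) (hc _), cfc_const_one ℝ Δ]
    rw [this]
    refine posSemidef_cfc fun x _ => ?_
    rcases lt_trichotomy x 0 with h | h | h <;> simp [h]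
  have h2S : (1 + S).PosSemidef := by
    have : 1 + S = cfc (fun x : ℝ => 1 + (SignType.sign x : ℝ)) Δ := by
      rw [cfc_add (a := Δ) (fun _ : ℝ => (1 : ℝ)) _ (hc _) (hc _), cfc_const_one ℝ Δ]
    rw [this]
    refine posSemidef_cfc fun x _ => ?_
    rcases lt_trichotomy x 0 with h | h | h <;> simp [h]
  have e1 := (Complex.le_def.mp (trace_mul_nonneg h1S hA)).1
  have e2 := (Complex.le_def.mp (trace_mul_nonneg h2S hB)).1
  rw [traceNorm_of_isHermitian hH, h1, hΔ, Matrix.mul_sub, Matrix.trace_sub]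
  simp only [Matrix.sub_mul, Matrix.add_mul, Matrix.one_mul, Matrix.trace_sub, Matrix.trace_add,
    Complex.sub_re, Complex.add_re, Complex.zero_re] at e1 e2 ⊢
  linarith

theorem traceNorm_nonneg (A : Matrix ι ι ℂ) : 0 ≤ traceNorm A :=
  (Complex.le_def.mp (posSemidef_cfc fun x _ => Real.sqrt_nonneg x).trace_nonneg).1

/-- `A ≤ |A|`, and the projection onto `ψ` is at most `1`, so its overlap with `|A|` is at most `Tr
|A|`. -/
theorem re_dotProduct_mulVec_le_traceNorm {A : Matrix ι ι ℂ} (hA : A.IsHermitian)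
    {ψ : ι → ℂ} (hψ : star ψ ⬝ᵥ ψ = 1) : (star ψ ⬝ᵥ (A *ᵥ ψ)).re ≤ traceNorm A := by
  set R := cfc (fun x : ℝ => |x|) A with hR
  have hRp : R.PosSemidef := posSemidef_cfc fun x _ => abs_nonneg x
  have h1 : (R - A).PosSemidef := by
    have : R - A = cfc (fun x : ℝ => |x| - x) A := by
      rw [cfc_sub (fun x : ℝ => |x|) (fun x : ℝ => x) A, cfc_id' ℝ A]
    rw [this]
    exact posSemidef_cfc fun x _ => sub_nonneg.mpr (le_abs_self x)
  have h2 : (1 - vecMulVec ψ (star ψ)).PosSemidef := by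
    set P := vecMulVec ψ (star ψ) with hP
    have hPH : Pᴴ = P := by simp [hP, conjTranspose_vecMulVec]
    have hPP : P * P = P := by
      rw [hP, vecMulVec_mul_vecMulVec, hψ, one_smul]
    have : 1 - P = (1 - P)ᴴ * (1 - P) := by
      rw [conjTranspose_sub, conjTranspose_one, hPH]
      simp [Matrix.mul_sub, Matrix.sub_mul, hPP]
    rw [this]
    exact posSemidef_conjTranspose_mul_self _
  have e1 := (Complex.le_def.mp (h1.dotProduct_mulVec_nonneg ψ)).1
  have e2 := (Complex.le_def.mp (trace_mul_nonneg hRp h2)).1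
  rw [Matrix.mul_sub, Matrix.mul_one, Matrix.trace_sub, Matrix.mul_vecMulVec,
    Matrix.trace_vecMulVec, dotProduct_comm] at e2
  rw [Matrix.sub_mulVec, dotProduct_sub] at e1
  rw [traceNorm_of_isHermitian hA]
  simp only [Complex.sub_re, Complex.zero_re] at e1 e2
  linarith

theorem msqrt_posSemidef (A : Matrix ι ι ℂ) : (msqrt A).PosSemidef :=
  posSemidef_cfc fun x _ => Real.sqrt_nonneg x

theorem msqrt_mul_msqrt {A : Matrix ι ι ℂ} (hA : A.PosSemidef) : msqrt A * msqrt A = A := by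
  rw [msqrt, ← cfc_mul Real.sqrt Real.sqrt A]
  conv_rhs => rw [← cfc_id' ℝ A hA.1]
  exact cfc_congr fun x hx => Real.mul_self_sqrt (spectrum_nonneg_of_posSemidef hA x hx)

theorem msqrt_mul_self {A : Matrix ι ι ℂ} (hA : A.PosSemidef) : msqrt (A * A) = A := by
  conv_lhs => enter [1, 1]; rw [← hA.1.eq]
  rw [msqrt_conjTranspose_mul_self hA.1]
  conv_rhs => rw [← cfc_id' ℝ A hA.1]
  exact cfc_congr fun x hx => abs_of_nonneg (spectrum_nonneg_of_posSemidef hA x hx)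

/-- The square root of `χ χ†` is `χ χ† / ‖χ‖`. The case `χ = 0` is split off because of the
division. -/
theorem trace_msqrt_vecMulVec (χ : ι → ℂ) :
    (msqrt (vecMulVec χ (star χ))).trace.re ^ 2 = (star χ ⬝ᵥ χ).re := by
  set s : ℝ := ∑ i, ‖χ i‖ ^ 2 with hs
  have hχ : star χ ⬝ᵥ χ = (s : ℂ) := dotProduct_star_self_eq χ
  have hs0 : 0 ≤ s := Finset.sum_nonneg fun i _ => by positivity
  rcases hs0.eq_or_lt with h0 | hpos
  · have : χ = 0 := dotProduct_star_self_eq_zero.mp (by rw [hχ, ← h0]; simp)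
    subst this
    have h0 : msqrt (0 : Matrix ι ι ℂ) = 0 := by
      have := msqrt_mul_self (Matrix.PosSemidef.zero (n := ι) (R := ℂ))
      simpa using this
    simp [h0]
  · set c : ℝ := (Real.sqrt s)⁻¹ with hc
    have hc0 : 0 ≤ c := by positivity
    have hcc : c * c * s = 1 := by
      rw [hc, ← mul_inv, Real.mul_self_sqrt hs0, inv_mul_cancel₀ hpos.ne']
    have hR : ((c : ℂ) • vecMulVec χ (star χ)).PosSemidef :=
      (posSemidef_vecMulVec_self_star χ).smul (by exact_mod_cast hc0)
    have h2 : vecMulVec χ (star χ)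
        = ((c : ℂ) • vecMulVec χ (star χ)) * ((c : ℂ) • vecMulVec χ (star χ)) := by
      rw [Matrix.smul_mul, Matrix.mul_smul, vecMulVec_mul_vecMulVec, hχ, vecMulVec_smul, smul_smul,
        smul_smul]
      have : (c : ℂ) * c * s = 1 := by exact_mod_cast hcc
      rw [this, one_smul]
    rw [h2, msqrt_mul_self hR, trace_smul, trace_vecMulVec, dotProduct_comm, hχ, smul_eq_mul,
      ← Complex.ofReal_mul, Complex.ofReal_re, Complex.ofReal_re]
    have : (c * s) ^ 2 = (c * c * s) * s := by ring
    rw [this, hcc, one_mul]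

/-- For a pure second argument the operator under the outer root has rank one. -/
theorem fidelity_vecMulVec {ρ : Matrix ι ι ℂ} (hρ : ρ.PosSemidef) (ψ : ι → ℂ) :
    fidelity ρ (vecMulVec ψ (star ψ)) = (star ψ ⬝ᵥ (ρ *ᵥ ψ)).re := by
  have hH : (msqrt ρ)ᴴ = msqrt ρ := (msqrt_posSemidef ρ).1
  have h : msqrt ρ * vecMulVec ψ (star ψ) * msqrt ρ
      = vecMulVec (msqrt ρ *ᵥ ψ) (star (msqrt ρ *ᵥ ψ)) := by
    rw [mul_vecMulVec, vecMulVec_mul, star_mulVec, hH]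
  rw [fidelity, h, trace_msqrt_vecMulVec, star_mulVec, hH, ← dotProduct_mulVec, mulVec_mulVec,
    msqrt_mul_msqrt hρ]

end TraceNorm

/-! ### Bounds on the worst-case error and fidelity -/

section WorstCase

variable {ι' κ : Type*} [Fintype ι'] [Fintype κ] [DecidableEq κ]

theorem Fwc_le {Φ Θ : SuperOp ι' κ} {k : ℕ} {ρ : Matrix (ι' × Fin k) (ι' × Fin k) ℂ}
    (hρ : IsState ρ) : Fwc Φ Θ ≤ fidelity (tensorMap Φ (LinearMap.id : SuperOp (Fin k) (Fin k)) ρ)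
      (tensorMap Θ (LinearMap.id : SuperOp (Fin k) (Fin k)) ρ) :=
  csInf_le ⟨0, by rintro _ ⟨k, ρ, _, rfl⟩; exact sq_nonneg _⟩ ⟨k, ρ, hρ, rfl⟩

/-- A real `sSup` is only useful for a bounded set; for channels the trace norms are at most 2. -/
theorem le_epsWc {Φ Θ : SuperOp ι' κ} (hΦ : IsChannel Φ) (hΘ : IsChannel Θ) {k : ℕ}
    {ρ : Matrix (ι' × Fin k) (ι' × Fin k) ℂ} (hρ : IsState ρ) :
    1 / 2 * traceNorm (tensorMap Φ (LinearMap.id : SuperOp (Fin k) (Fin k)) ρ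
      - tensorMap Θ (LinearMap.id : SuperOp (Fin k) (Fin k)) ρ) ≤ epsWc Φ Θ := by
  refine mul_le_mul_of_nonneg_left (le_csSup ⟨2, ?_⟩ ⟨k, ρ, hρ, rfl⟩) (by norm_num)
  rintro _ ⟨k, ρ, hρ, rfl⟩
  refine (traceNorm_sub_le (hΦ.1 k ρ hρ.1) (hΘ.1 k ρ hρ.1)).trans ?_
  rw [trace_tensorMap_id_of_isChannel hΦ.2, trace_tensorMap_id_of_isChannel hΘ.2, hρ.2]
  norm_num

/-- The sign condition on `c` covers an input system without states, where the supremum is over the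
empty set and equals 0. -/
theorem epsWc_le {Φ Θ : SuperOp ι' κ} {c : ℝ} (hc : 0 ≤ c)
    (h : ∀ (k : ℕ) (ρ : Matrix (ι' × Fin k) (ι' × Fin k) ℂ), IsState ρ →
      traceNorm (tensorMap Φ (LinearMap.id : SuperOp (Fin k) (Fin k)) ρ
        - tensorMap Θ (LinearMap.id : SuperOp (Fin k) (Fin k)) ρ) ≤ 2 * c) :
    epsWc Φ Θ ≤ c := by
  have : sSup {x : ℝ | ∃ (k : ℕ) (ρ : Matrix (ι' × Fin k) (ι' × Fin k) ℂ), IsState ρ ∧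
    x = traceNorm (tensorMap Φ (LinearMap.id : SuperOp (Fin k) (Fin k)) ρ
      - tensorMap Θ (LinearMap.id : SuperOp (Fin k) (Fin k)) ρ)} ≤ 2 * c := by
    refine Real.sSup_le ?_ (by positivity)
    rintro _ ⟨k, ρ, hρ, rfl⟩
    exact h k ρ hρ
  rw [epsWc]
  linarith

end WorstCase

/-! ### Haar integrals of matrix-valued functions -/

section HaarIntegral

variable {d : ℕ} {ι κ : Type*}

instance : (haarSU d).IsHaarMeasure := by unfold haarSU; infer_instance

instance : IsProbabilityMeasure (haarSU d) where
  measure_univ := by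
    have := Measure.haarMeasure_self (K₀ := (⊤ : TopologicalSpace.PositiveCompacts (SU d)))
    simpa [haarSU] using this

theorem integrable_haarSU {E : Type*} [NormedAddCommGroup E] [SecondCountableTopology E]
    {f : SU d → E} (hf : Continuous f) : Integrable f (haarSU d) :=
  hf.integrable_of_hasCompactSupport (HasCompactSupport.of_compactSpace f)

theorem continuous_linearMap_apply [Finite ι] {X V : Type*} [TopologicalSpace X]
    [AddCommGroup V] [Module ℂ V] [TopologicalSpace V] [IsTopologicalAddGroup V]
    [ContinuousSMul ℂ V] {F : X → Matrix ι ι ℂ} (hF : Continuous F) (ℓ : Matrix ι ι ℂ →ₗ[ℂ] V) :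
    Continuous fun U => ℓ (F U) :=
  ℓ.continuous_of_finiteDimensional.comp hF

/-- Expanding in matrix units reduces the interchange to finite sums of integrals of entries. All
later interchanges of Haar integrals with linear maps rest on it; continuity gives integrability
because `SU d` is compact. -/
theorem haarMat_functional [Fintype ι] [DecidableEq ι] {F : SU d → Matrix ι ι ℂ}
    (hF : Continuous F) (ℓ : Matrix ι ι ℂ →ₗ[ℂ] ℂ) :
    ℓ (haarMat F) = ∫ U, ℓ (F U) ∂haarSU d := by
  have hint : ∀ i j, Integrable (fun U => F U i j • ℓ (Matrix.single i j 1)) (haarSU d) :=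
    fun i j => integrable_haarSU ((hF.matrix_elem i j).smul continuous_const)
  simp only [superOp_apply_eq_sum ℓ (F _)]
  rw [superOp_apply_eq_sum ℓ (haarMat F), integral_finsetSum _ fun i _ =>
    integrable_finsetSum _ fun j _ => hint i j]
  refine Finset.sum_congr rfl fun i _ => ?_
  rw [integral_finsetSum _ fun j _ => hint i j]
  refine Finset.sum_congr rfl fun j _ => ?_
  rw [integral_smul_const]
  rfl

theorem map_haarMat [Fintype ι] [DecidableEq ι] {F : SU d → Matrix ι ι ℂ}
    (hF : Continuous F) (L : SuperOp ι κ) : L (haarMat F) = haarMat fun U => L (F U) := by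
  ext a b
  exact haarMat_functional hF ((Matrix.entryLinearMap ℂ ℂ a b) ∘ₗ L)

theorem trace_haarMat [Fintype ι] [DecidableEq ι] {F : SU d → Matrix ι ι ℂ} (hF : Continuous F) :
    (haarMat F).trace = ∫ U, (F U).trace ∂haarSU d :=
  haarMat_functional hF (Matrix.traceLinearMap ι ℂ ℂ)

theorem haarMat_sum {J : Type*} (s : Finset J) {F : J → SU d → Matrix ι ι ℂ}
    (hF : ∀ j ∈ s, Continuous (F j)) :
    haarMat (fun U => ∑ j ∈ s, F j U) = ∑ j ∈ s, haarMat (F j) := by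
  ext a b
  simp only [haarMat, Matrix.of_apply, Matrix.sum_apply]
  exact integral_finsetSum _ fun j hj => integrable_haarSU ((hF j hj).matrix_elem a b)

theorem haarMat_add {F G : SU d → Matrix ι ι ℂ} (hF : Continuous F) (hG : Continuous G) :
    haarMat (fun U => F U + G U) = haarMat F + haarMat G := by
  ext a b
  exact integral_add (integrable_haarSU (hF.matrix_elem a b)) (integrable_haarSU (hG.matrix_elem a b))

theorem haarMat_sub {F G : SU d → Matrix ι ι ℂ} (hF : Continuous F) (hG : Continuous G) :
    haarMat (fun U => F U - G U) = haarMat F - haarMat G := by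
  ext a b
  exact integral_sub (integrable_haarSU (hF.matrix_elem a b)) (integrable_haarSU (hG.matrix_elem a b))

theorem haarMat_smul (c : ℂ) (F : SU d → Matrix ι ι ℂ) :
    haarMat (fun U => c • F U) = c • haarMat F := by
  ext a b
  exact integral_const_mul c _

theorem haarMat_const (A : Matrix ι ι ℂ) : haarMat (fun _ : SU d => A) = A := by
  ext a b
  simp [haarMat]

theorem haarMat_mul_left (F : SU d → Matrix ι ι ℂ) (V : SU d) :
    haarMat (fun U => F (V * U)) = haarMat F := by
  ext a b
  exact integral_mul_left_eq_self (fun U => F U a b) V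

theorem haarMat_conjTranspose (F : SU d → Matrix ι ι ℂ) :
    (haarMat F)ᴴ = haarMat fun U => (F U)ᴴ := by
  ext a b
  exact (integral_conj (f := fun U => F U b a)).symm

theorem integral_nonneg_complex {f : SU d → ℂ} (h : ∀ U, 0 ≤ f U) :
    0 ≤ ∫ U, f U ∂haarSU d := by
  have : ∀ U, f U = ((f U).re : ℂ) := fun U =>
    Complex.ext rfl (by simpa using (Complex.le_def.mp (h U)).2.symm)
  rw [integral_congr_ae (Filter.Eventually.of_forall this)]
  erw [integral_ofReal]
  exact Complex.zero_le_real.mpr (integral_nonneg fun U => (Complex.le_def.mp (h U)).1)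

theorem haarMat_posSemidef [Fintype ι] {F : SU d → Matrix ι ι ℂ} (hF : Continuous F)
    (h : ∀ U, (F U).PosSemidef) : (haarMat F).PosSemidef := by
  classical
  refine .of_dotProduct_mulVec_nonneg ?_ fun x => ?_
  · rw [Matrix.IsHermitian, haarMat_conjTranspose]
    exact congrArg haarMat (funext fun U => (h U).1)
  · let ℓ : Matrix ι ι ℂ →ₗ[ℂ] ℂ :=
      { toFun := fun A => star x ⬝ᵥ (A *ᵥ x)
        map_add' := fun A B => by rw [Matrix.add_mulVec, dotProduct_add]
        map_smul' := fun c A => by rw [Matrix.smul_mulVec, dotProduct_smul]; rfl }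
    have := haarMat_functional hF ℓ
    change ℓ (haarMat F) ≥ 0
    rw [this]
    exact integral_nonneg_complex fun U => (h U).dotProduct_mulVec_nonneg x

theorem haarMap_apply [Fintype ι] [DecidableEq ι] {F : SU d → SuperOp ι κ}
    (hF : ∀ X, Continuous fun U => F U X) (X : Matrix ι ι ℂ) :
    haarMap F X = haarMat fun U => F U X := by
  simp only [superOp_apply_eq_sum (F _) X]
  have hc : ∀ i j, Continuous fun U => X i j • F U (Matrix.single i j 1) := fun i j =>
    (hF (Matrix.single i j 1)).const_smul (X i j)
  rw [haarMat_sum _ fun i _ => continuous_finsetSum _ fun j _ => hc i j]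
  rw [haarMap, LinearMap.sum_apply]
  refine Finset.sum_congr rfl fun i _ => ?_
  rw [haarMat_sum _ fun j _ => hc i j, LinearMap.sum_apply]
  refine Finset.sum_congr rfl fun j _ => ?_
  rw [haarMat_smul]
  rfl

theorem tensorMap_haarMap [Fintype ι] [DecidableEq ι] {ι' : Type*} {F : SU d → SuperOp ι ι'}
    (hF : ∀ X, Continuous fun U => F U X) (X : Matrix (ι × κ) (ι × κ) ℂ) :
    tensorMap (haarMap F) (LinearMap.id : SuperOp κ κ) X
      = haarMat fun U => tensorMap (F U) (LinearMap.id : SuperOp κ κ) X := by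
  ext a b
  rw [tensorMap_id_apply, haarMap_apply hF]
  rfl

theorem continuous_tensorMap_id {ι' : Type*} {F : SU d → SuperOp ι ι'}
    (hF : ∀ X, Continuous fun U => F U X) (X : Matrix (ι × κ) (ι × κ) ℂ) :
    Continuous fun U => tensorMap (F U) (LinearMap.id : SuperOp κ κ) X := by
  refine continuous_matrix fun a b => ?_
  exact (hF _).matrix_elem a.1 b.1

theorem continuous_coe_SU :
    Continuous fun U : SU d => (U : Matrix (Fin d) (Fin d) ℂ) := continuous_subtype_val

theorem continuous_coe_inv_SU :
    Continuous fun U : SU d => ((U⁻¹ : SU d) : Matrix (Fin d) (Fin d) ℂ) :=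
  continuous_subtype_val.comp continuous_inv

theorem continuous_conjMap [Fintype ι] {A : SU d → Matrix κ ι ℂ} (hA : Continuous A)
    {F : SU d → Matrix ι ι ℂ} (hF : Continuous F) : Continuous fun U => conjMap (A U) (F U) :=
  (hA.matrix_mul hF).matrix_mul hA.matrix_conjTranspose

theorem coe_inv_SU (U : SU d) :
    ((U⁻¹ : SU d) : Matrix (Fin d) (Fin d) ℂ) = (U : Matrix (Fin d) (Fin d) ℂ)ᴴ := rfl

theorem SU_conjTranspose_mul (U : SU d) :
    (U : Matrix (Fin d) (Fin d) ℂ)ᴴ * (U : Matrix (Fin d) (Fin d) ℂ) = 1 := by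
  rw [← coe_inv_SU, ← Submonoid.coe_mul, inv_mul_cancel]; rfl

end HaarIntegral

/-! ### Schur's lemma for the defining representation of `SU(d)` and twirling -/

section Twirl

variable {d : ℕ}

theorem diagonal_mem_SU {v : Fin d → ℂ} (hv : ∀ a, star (v a) * v a = 1) (hp : ∏ a, v a = 1) :
    Matrix.diagonal v ∈ Matrix.specialUnitaryGroup (Fin d) ℂ := by
  rw [Matrix.mem_specialUnitaryGroup_iff, Matrix.mem_unitaryGroup_iff', Matrix.det_diagonal]
  refine ⟨?_, hp⟩
  rw [Matrix.star_eq_conjTranspose, Matrix.diagonal_conjTranspose, Matrix.diagonal_mul_diagonal,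
    ← Matrix.diagonal_one]
  exact congrArg _ (funext hv)

theorem diagonal_mul_perm_mem_SU {v : Fin d → ℂ} (hv : ∀ a, star (v a) * v a = 1)
    (σ : Equiv.Perm (Fin d)) (hp : (∏ a, v a) * (Equiv.Perm.sign σ : ℤ) = 1) :
    Matrix.diagonal v * σ.permMatrix ℂ ∈ Matrix.specialUnitaryGroup (Fin d) ℂ := by
  rw [Matrix.mem_specialUnitaryGroup_iff, Matrix.mem_unitaryGroup_iff', Matrix.det_mul,
    Matrix.det_diagonal, Matrix.det_permutation]
  refine ⟨?_, by simpa using hp⟩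
  rw [Matrix.star_eq_conjTranspose, conjTranspose_mul, Matrix.mul_assoc,
    ← Matrix.mul_assoc (Matrix.diagonal v)ᴴ, Matrix.diagonal_conjTranspose,
    Matrix.diagonal_mul_diagonal]
  have : (Matrix.diagonal fun i => star v i * v i) = (1 : Matrix (Fin d) (Fin d) ℂ) := by
    rw [← Matrix.diagonal_one]; exact congrArg _ (funext hv)
  rw [this, Matrix.one_mul, Matrix.conjTranspose_permMatrix, ← Matrix.permMatrix_mul]
  simp

/-- Schur's lemma by hand: diagonal elements of `SU d` force `Y` to be diagonal, signed
transpositions make the diagonal constant. -/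
theorem eq_smul_one_of_commute {Y : Matrix (Fin d) (Fin d) ℂ}
    (hY : ∀ V : SU d, (V : Matrix (Fin d) (Fin d) ℂ) * Y = Y * (V : Matrix (Fin d) (Fin d) ℂ)) :
    Y = (Y.trace / d) • (1 : Matrix (Fin d) (Fin d) ℂ) := by
  have hoff : ∀ a b, a ≠ b → Y a b = 0 := by
    intro a b hab
    -- The phases `i` and `-i` have product 1 and differ, so commuting gives `i Y a b = -i Y a b`.
    let v : Fin d → ℂ := fun c => if c = a then Complex.I else if c = b then -Complex.I else 1
    have hv : ∀ c, star (v c) * v c = 1 := by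
      intro c; simp only [v]; split_ifs <;> simp
    have hp : ∏ c, v c = 1 := by
      rw [← Finset.mul_prod_erase _ _ (Finset.mem_univ a),
        ← Finset.mul_prod_erase _ _ (Finset.mem_erase.mpr ⟨hab.symm, Finset.mem_univ b⟩),
        Finset.prod_eq_one]
      · simp [v, hab.symm]
      · intro c hc
        simp only [Finset.mem_erase] at hc
        simp [v, hc.1, hc.2.1]
    have h := congrFun (congrFun (hY ⟨_, diagonal_mem_SU hv hp⟩) a) b
    simp only [Matrix.diagonal_mul, Matrix.mul_diagonal] at h
    simp only [v, if_true, hab.symm, if_false] at h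
    have h2 : Complex.I * (2 * Y a b) = 0 := by linear_combination h
    simpa using h2
  have hdiag : ∀ a b, Y a a = Y b b := by
    intro a b
    rcases eq_or_ne a b with rfl | hab
    · rfl
    -- One sign is flipped to compensate the determinant `-1` of the transposition.
    let v : Fin d → ℂ := fun c => if c = a then -1 else 1
    have hv : ∀ c, star (v c) * v c = 1 := by
      intro c; simp only [v]; split_ifs <;> simp
    have hp : (∏ c, v c) * (Equiv.Perm.sign (Equiv.swap a b) : ℤ) = 1 := by
      rw [Equiv.Perm.sign_swap hab]
      simp [v, Finset.prod_ite_eq']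
    have h := congrFun (congrFun (hY ⟨_, diagonal_mul_perm_mem_SU hv _ hp⟩) a) b
    have hYd : Y = Matrix.diagonal fun c => Y c c := by
      ext i j
      rcases eq_or_ne i j with rfl | hij
      · simp
      · rw [hoff i j hij, Matrix.diagonal_apply_ne _ hij]
    rw [hYd] at h
    simp only [Matrix.mul_diagonal, Matrix.diagonal_mul] at h
    simp [v, Equiv.Perm.permMatrix, PEquiv.toMatrix_apply] at h
    exact h.symm
  have htr : ∀ a, Y.trace = d * Y a a := by
    intro a
    simp [Matrix.trace, hdiag _ a]
  ext a b
  have hd : (d : ℂ) ≠ 0 := by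
    have := a.pos
    exact_mod_cast this.ne'
  rcases eq_or_ne a b with rfl | hab
  · rw [htr a]; simp [mul_div_cancel_left₀ _ hd]
  · simp [hoff a b hab, hab]

/-- Left invariance makes the average commute with `SU d`, so it is a scalar, which the preserved
trace determines. -/
theorem haarMat_conj (x : Matrix (Fin d) (Fin d) ℂ) :
    haarMat (fun U : SU d => conjMap (U : Matrix (Fin d) (Fin d) ℂ) x)
      = (x.trace / d) • (1 : Matrix (Fin d) (Fin d) ℂ) := by
  set Y := haarMat (fun U : SU d => conjMap (U : Matrix (Fin d) (Fin d) ℂ) x) with hYdef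
  have hcont : Continuous fun U : SU d => conjMap (U : Matrix (Fin d) (Fin d) ℂ) x :=
    continuous_conjMap continuous_coe_SU continuous_const
  have hconj : ∀ V : SU d, conjMap (V : Matrix (Fin d) (Fin d) ℂ) Y = Y := by
    intro V
    rw [hYdef, map_haarMat hcont]
    rw [← haarMat_mul_left (fun U : SU d => conjMap (U : Matrix (Fin d) (Fin d) ℂ) x) V]
    refine congrArg haarMat (funext fun U => ?_)
    rw [Submonoid.coe_mul, ← conjMap_comp, LinearMap.comp_apply]
  have htr : Y.trace = x.trace := by
    rw [hYdef, trace_haarMat hcont]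
    simp [conjMap_trace (SU_conjTranspose_mul _)]
  rw [← htr]
  refine eq_smul_one_of_commute fun V => ?_
  conv_rhs => rw [← hconj V, conjMap_apply, Matrix.mul_assoc, SU_conjTranspose_mul, Matrix.mul_one]

/-- The twirl `∫ dU U ∘ Φ ∘ U⁻¹`. -/
def twirl (Φ : SuperOp (Fin d) (Fin d)) : SuperOp (Fin d) (Fin d) :=
  haarMap fun U : SU d => conjMap (U : Matrix (Fin d) (Fin d) ℂ) ∘ₗ Φ
    ∘ₗ conjMap ((U⁻¹ : SU d) : Matrix (Fin d) (Fin d) ℂ)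

/-- The entanglement fidelity of a map. -/
def entFid (Φ : SuperOp (Fin d) (Fin d)) : ℂ :=
  (∑ i, ∑ j, Φ (Matrix.single i j 1) i j) / (d : ℂ) ^ 2

/-- In Kraus form the entanglement fidelity is `∑ |tr K|² / d²`: the squared moduli of the scalars
to which the `K` average under conjugation. -/
theorem entFid_sum_conjMap {C : Type*} [Fintype C] (K : C → Matrix (Fin d) (Fin d) ℂ) :
    entFid (∑ c, conjMap (K c)) = ((∑ c, ‖(K c).trace‖ ^ 2 / (d : ℝ) ^ 2 : ℝ) : ℂ) := by
  have h : ∀ c, ∑ i, ∑ j, conjMap (K c) (Matrix.single i j 1) i j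
      = ((‖(K c).trace‖ ^ 2 : ℝ) : ℂ) := by
    intro c
    push_cast
    rw [← Complex.mul_conj', Matrix.trace, map_sum, Finset.sum_mul_sum]
    refine Finset.sum_congr rfl fun i _ => Finset.sum_congr rfl fun j _ => ?_
    simp [conjMap_apply, Matrix.mul_apply, Matrix.single_apply, ite_and]
  simp only [entFid, LinearMap.sum_apply, Matrix.sum_apply]
  simp only [Finset.sum_comm (t := (Finset.univ : Finset C)), h, ← Finset.sum_div]
  push_cast
  rfl

theorem continuous_twirl_integrand (Φ : SuperOp (Fin d) (Fin d)) (X : Matrix (Fin d) (Fin d) ℂ) :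
    Continuous fun U : SU d => (conjMap (U : Matrix (Fin d) (Fin d) ℂ) ∘ₗ Φ
      ∘ₗ conjMap ((U⁻¹ : SU d) : Matrix (Fin d) (Fin d) ℂ)) X :=
  continuous_conjMap continuous_coe_SU
    (continuous_linearMap_apply (continuous_conjMap continuous_coe_inv_SU continuous_const) Φ)

/-- Up to a completely positive remainder, a twirled completely positive map is the identity with
weight the entanglement fidelity. -/
theorem posSemidef_twirl_sub {Φ : SuperOp (Fin d) (Fin d)} (hΦ : IsCP Φ) {k : ℕ}
    {ρ : Matrix (Fin d × Fin k) (Fin d × Fin k) ℂ} (hρ : ρ.PosSemidef) :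
    (tensorMap (twirl Φ) (LinearMap.id : SuperOp (Fin k) (Fin k)) ρ - entFid Φ • ρ).PosSemidef := by
  obtain ⟨r, K, rfl⟩ := hΦ.exists_kraus
  let t : Fin r → ℂ := fun c => (K c).trace / d
  let A : Fin r → SU d → Matrix (Fin d) (Fin d) ℂ := fun c U => conjMap (U : Matrix _ _ ℂ) (K c)
  have hA : ∀ c, Continuous (A c) := fun c => continuous_conjMap continuous_coe_SU continuous_const
  let Lm : SuperOp (Fin d) (Fin d × Fin k) :=
    { toFun := fun M => M ⊗ₖ (1 : Matrix (Fin k) (Fin k) ℂ) * ρ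
      map_add' := fun M N => by rw [Matrix.add_kronecker, Matrix.add_mul]
      map_smul' := fun c M => by rw [Matrix.smul_kronecker, Matrix.smul_mul, RingHom.id_apply] }
  let Rm : SuperOp (Fin d) (Fin d × Fin k) :=
    { toFun := fun M => ρ * M ⊗ₖ (1 : Matrix (Fin k) (Fin k) ℂ)
      map_add' := fun M N => by rw [Matrix.add_kronecker, Matrix.mul_add]
      map_smul' := fun c M => by rw [Matrix.smul_kronecker, Matrix.mul_smul, RingHom.id_apply] }
  let G : Fin r → SU d → Matrix (Fin d × Fin k) (Fin d × Fin k) ℂ := fun c U =>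
    conjMap (A c U ⊗ₖ (1 : Matrix (Fin k) (Fin k) ℂ)) ρ
  have hAk : ∀ c, Continuous fun U => A c U ⊗ₖ (1 : Matrix (Fin k) (Fin k) ℂ) := fun c =>
    continuous_matrix fun a b => ((hA c).matrix_elem a.1 b.1).mul continuous_const
  have hG : ∀ c, Continuous (G c) := fun c => continuous_conjMap (hAk c) continuous_const
  have h1 : tensorMap (twirl (∑ c, conjMap (K c))) (LinearMap.id : SuperOp (Fin k) (Fin k)) ρ
      = ∑ c, haarMat (G c) := by
    rw [twirl, tensorMap_haarMap (continuous_twirl_integrand _), ← haarMat_sum _ fun c _ => hG c]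
    refine congrArg haarMat (funext fun U => ?_)
    have : conjMap (U : Matrix (Fin d) (Fin d) ℂ) ∘ₗ (∑ c, conjMap (K c))
        ∘ₗ conjMap ((U⁻¹ : SU d) : Matrix (Fin d) (Fin d) ℂ) = ∑ c, conjMap (A c U) := by
      ext1 X
      simp only [LinearMap.comp_apply, LinearMap.sum_apply, map_sum]
      refine Finset.sum_congr rfl fun c _ => ?_
      simp only [A, conjMap_apply, coe_inv_SU, conjTranspose_mul, conjTranspose_conjTranspose,
        Matrix.mul_assoc]
    rw [this, tensorMap_sum_id]
    exact Finset.sum_congr rfl fun c _ => tensorMap_conjMap_id _ _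
  have hmean : ∀ c, haarMat (A c) = t c • 1 := fun c => haarMat_conj (K c)
  have hmean' : ∀ c, haarMat (fun U => (A c U)ᴴ) = star (t c) • 1 := fun c => by
    rw [← haarMat_conjTranspose, hmean, conjTranspose_smul, conjTranspose_one]
  -- The variance identity: averaging `(A - t) ρ (A - t)†`, where `t · 1` is the mean of `A`, leaves
  -- the average of `A ρ A†` minus `|t|² ρ`, and the averaged operators are positive.
  have hB : ∀ c, (haarMat (G c) - (t c * star (t c)) • ρ).PosSemidef := by
    intro c
    have e : ∀ U, conjMap ((A c U - t c • 1) ⊗ₖ (1 : Matrix (Fin k) (Fin k) ℂ)) ρ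
        = G c U - star (t c) • Lm (A c U) - t c • Rm (A c U)ᴴ + (t c * star (t c)) • ρ := by
      intro U
      change _ = (A c U ⊗ₖ 1) * ρ * (A c U ⊗ₖ 1)ᴴ - star (t c) • (A c U ⊗ₖ 1 * ρ)
        - t c • (ρ * (A c U)ᴴ ⊗ₖ 1) + _
      have hs : (A c U - t c • 1) ⊗ₖ (1 : Matrix (Fin k) (Fin k) ℂ)
          = A c U ⊗ₖ 1 - t c • 1 := by
        rw [sub_eq_add_neg, ← neg_one_smul ℂ (t c • _), Matrix.add_kronecker,
          Matrix.smul_kronecker, Matrix.smul_kronecker, Matrix.one_kronecker_one, neg_one_smul,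
          ← sub_eq_add_neg]
      rw [conjMap_apply, hs, conjTranspose_sub, conjTranspose_smul, conjTranspose_one,
        conjTranspose_kronecker, conjTranspose_one]
      simp only [Matrix.sub_mul, Matrix.mul_sub, Matrix.smul_mul, Matrix.mul_smul, Matrix.one_mul,
        Matrix.mul_one, smul_sub, smul_smul, mul_comm (star (t c))]
      abel
    have hAs : Continuous fun U => (A c U)ᴴ := (hA c).matrix_conjTranspose
    have c1 : Continuous fun U => star (t c) • Lm (A c U) :=
      (continuous_linearMap_apply (hA c) Lm).const_smul (star (t c))
    have c2 : Continuous fun U => t c • Rm (A c U)ᴴ := 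
      (continuous_linearMap_apply hAs Rm).const_smul (t c)
    have hp : (haarMat fun U => conjMap ((A c U - t c • 1) ⊗ₖ
        (1 : Matrix (Fin k) (Fin k) ℂ)) ρ).PosSemidef := by
      refine haarMat_posSemidef ?_ fun U => conjMap_posSemidef _ hρ
      simp only [e]
      exact (((hG c).sub c1).sub c2).add continuous_const
    simp only [e] at hp
    have c3 : Continuous fun U => G c U - star (t c) • Lm (A c U) := (hG c).sub c1
    have c4 : Continuous fun U => G c U - star (t c) • Lm (A c U) - t c • Rm (A c U)ᴴ := c3.sub c2
    rw [haarMat_add c4 continuous_const, haarMat_sub c3 c2,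
      haarMat_sub (hG c) c1, haarMat_smul, haarMat_smul, ← map_haarMat (hA c) Lm,
      ← map_haarMat hAs Rm, hmean, hmean', haarMat_const, map_smul, map_smul] at hp
    have eL : Lm 1 = ρ := by change (1 ⊗ₖ 1) * ρ = ρ; simp
    have eR : Rm 1 = ρ := by change ρ * (1 ⊗ₖ 1) = ρ; simp
    rw [eL, eR, smul_smul, smul_smul, mul_comm (star (t c)) (t c)] at hp
    convert hp using 1
    abel
  have h2 : entFid (∑ c, conjMap (K c)) = ∑ c, t c * star (t c) := by
    rw [entFid_sum_conjMap]
    push_cast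
    refine Finset.sum_congr rfl fun c _ => ?_
    simp only [t, RCLike.star_def, Complex.mul_conj', norm_div, Complex.norm_natCast]
    push_cast
    ring
  rw [h1, h2, Finset.sum_smul, ← Finset.sum_sub_distrib]
  exact Matrix.posSemidef_sum _ fun c _ => hB c

theorem trace_tensorMap_twirl {Φ : SuperOp (Fin d) (Fin d)} {q : ℂ}
    (hΦ : ∀ X, (Φ X).trace = q * X.trace) {k : ℕ}
    (ρ : Matrix (Fin d × Fin k) (Fin d × Fin k) ℂ) :
    (tensorMap (twirl Φ) (LinearMap.id : SuperOp (Fin k) (Fin k)) ρ).trace = q * ρ.trace := by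
  rw [trace_tensorMap_id, trace_eq_sum_block, Finset.mul_sum]
  refine Finset.sum_congr rfl fun l _ => ?_
  rw [twirl, haarMap_apply (continuous_twirl_integrand Φ),
    trace_haarMat (continuous_twirl_integrand Φ _)]
  simp only [LinearMap.comp_apply, conjMap_trace (SU_conjTranspose_mul _), hΦ]
  simp

end Twirl

/-! ### The actions of `SU(d)` on the registers -/

section PiKron

variable {K : Type*} [Fintype K] {β γ δ : K → Type*}

theorem piKron_mul [DecidableEq K] [∀ k, Fintype (γ k)] (M : ∀ k, Matrix (β k) (γ k) ℂ)
    (N : ∀ k, Matrix (γ k) (δ k) ℂ) : piKron M * piKron N = piKron fun k => M k * N k := by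
  ext x y
  simp only [piKron, Matrix.mul_apply, Matrix.of_apply, ← Finset.prod_mul_distrib]
  rw [Finset.prod_univ_sum, Fintype.piFinset_univ]

theorem piKron_one [∀ k, DecidableEq (β k)] [DecidableEq (∀ k, β k)] :
    piKron (fun k => (1 : Matrix (β k) (β k) ℂ)) = 1 := by
  ext x y
  simp only [piKron, Matrix.of_apply, Matrix.one_apply, Finset.prod_ite_zero, Finset.mem_univ,
    forall_true_left, funext_iff]
  simp

theorem piKron_conjTranspose (M : ∀ k, Matrix (β k) (γ k) ℂ) :
    (piKron M)ᴴ = piKron fun k => (M k)ᴴ := by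
  ext x y
  simp [piKron, conjTranspose_apply]

theorem continuous_piKron {X : Type*} [TopologicalSpace X] {M : X → ∀ k, Matrix (β k) (γ k) ℂ}
    (hM : ∀ k, Continuous fun x => M x k) : Continuous fun x => piKron (M x) :=
  continuous_matrix fun a b => continuous_finsetProd _ fun k _ => (hM k).matrix_elem (a k) (b k)

end PiKron

section ActionLemmas

variable {d m sR : ℕ} {Er : Fin sR → Type*}

theorem actQ_mul (n : ℕ) (U V : SU d) : actQ n (U * V) = actQ n U * actQ n V := by
  rw [actQ, actQ, actQ, piKron_mul]; rfl

theorem actQ_one (n : ℕ) : actQ n (1 : SU d) = 1 := piKron_one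

theorem actQ_inv (n : ℕ) (U : SU d) : actQ n U⁻¹ = (actQ n U)ᴴ := by
  rw [actQ, actQ, piKron_conjTranspose]; rfl

theorem continuous_actQ (n : ℕ) : Continuous (actQ n : SU d → _) :=
  continuous_piKron fun _ => continuous_coe_SU

theorem actQ_mul_conjTranspose (n : ℕ) (U : SU d) : actQ n U * (actQ n U)ᴴ = 1 := by
  rw [← actQ_inv, ← actQ_mul, mul_inv_cancel, actQ_one]

theorem actQ_conjTranspose_mul (n : ℕ) (U : SU d) : (actQ n U)ᴴ * actQ n U = 1 := by
  rw [← actQ_inv, ← actQ_mul, inv_mul_cancel, actQ_one]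

theorem actFrame_mul (U V : SU d) : actFrame m (U * V) = actFrame m U * actFrame m V := by
  rw [actFrame, actQ_mul, actFrame, actFrame, ← Matrix.mul_kronecker_mul, Matrix.one_mul]

theorem actFrames_mul (K : Type*) [Fintype K] [DecidableEq K] (U V : SU d) :
    actFrames m K (U * V) = actFrames m K U * actFrames m K V := by
  rw [actFrames, actFrames, actFrames, piKron_mul]
  simp only [actFrame_mul]

theorem continuous_actFrame : Continuous (actFrame m : SU d → _) :=
  continuous_matrix fun a b =>
    ((continuous_actQ m).matrix_elem a.1 b.1).mul continuous_const

theorem continuous_actFrames (K : Type*) [Fintype K] : Continuous (actFrames m K : SU d → _) :=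
  continuous_piKron fun _ => continuous_actFrame

end ActionLemmas

/-! ### The entanglement fidelity of a code whose decoder is rotated at random -/

section EntanglementFidelity

/-- Write `v = c u + w` with `w` orthogonal to `u`. Then `c u - w` is also a unit vector, and the
parallelogram law for the images under `L` gives `‖L v‖² ≥ 2 |c|² ‖L u‖² - 1`. -/
theorem one_sub_norm_sq_le {E F : Type*} [NormedAddCommGroup E] [InnerProductSpace ℂ E]
    [NormedAddCommGroup F] [InnerProductSpace ℂ F] (L : E →ₗ[ℂ] F) (hL : ∀ x, ‖L x‖ ≤ ‖x‖)
    {u v : E} (hu : ‖u‖ = 1) (hv : ‖v‖ = 1) :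
    1 - ‖L v‖ ^ 2 ≤ 2 * (1 - ‖L u‖ ^ 2) + 2 * (1 - ‖inner ℂ u v‖ ^ 2) := by
  set c : ℂ := inner ℂ u v
  set w := v - c • u with hw
  have horth : inner ℂ (c • u) w = 0 := by
    rw [hw, inner_sub_right, inner_smul_left, inner_smul_left, inner_smul_right,
      inner_self_eq_norm_sq_to_K, hu]
    simp [c]
  have hvw : v = c • u + w := by rw [hw]; abel
  have hn : ‖v‖ ^ 2 = ‖c • u‖ ^ 2 + ‖w‖ ^ 2 := by
    rw [hvw, sq, sq, sq]
    exact norm_add_sq_eq_norm_sq_add_norm_sq_of_inner_eq_zero _ _ horth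
  have hcu : ‖c • u‖ ^ 2 = ‖c‖ ^ 2 := by rw [norm_smul, hu, mul_one]
  have hLcu : ‖L (c • u)‖ ^ 2 = ‖c‖ ^ 2 * ‖L u‖ ^ 2 := by rw [map_smul, norm_smul, mul_pow]
  have p1 := parallelogram_law_with_norm ℂ (c • u) w
  have p2 := parallelogram_law_with_norm ℂ (L (c • u)) (L w)
  rw [← map_add, ← map_sub, ← hvw] at p2
  rw [← hvw] at p1
  have h3 : ‖L (c • u - w)‖ ^ 2 ≤ ‖c • u - w‖ ^ 2 := by gcongr; exact hL _
  have h4 : 0 ≤ ‖L w‖ ^ 2 := sq_nonneg _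
  have h5 : ‖L u‖ ^ 2 ≤ 1 := by
    have := hL u; rw [hu] at this
    exact pow_le_one₀ (norm_nonneg _) this
  have h6 : ‖c‖ ^ 2 ≤ 1 := by
    rw [hv] at hn; nlinarith [sq_nonneg ‖w‖]
  -- Turns `1 - |c|² ‖L u‖²` into the sum of the two defects.
  have h7 : 0 ≤ (1 - ‖c‖ ^ 2) * (1 - ‖L u‖ ^ 2) :=
    mul_nonneg (sub_nonneg.mpr h6) (sub_nonneg.mpr h5)
  rw [hv] at hn
  rw [hv] at p1
  nlinarith

variable {d : ℕ} {π : Type*} [Fintype π]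

/-- The vector of the maximally entangled state. -/
def maxEnt (d : ℕ) : Fin d × Fin d → ℂ := fun x => if x.1 = x.2 then ((√d : ℝ) : ℂ)⁻¹ else 0

theorem inv_sqrt_mul_inv_sqrt (d : ℕ) :
    ((√d : ℝ) : ℂ)⁻¹ * ((√d : ℝ) : ℂ)⁻¹ = (d : ℂ)⁻¹ := by
  rw [← mul_inv, ← Complex.ofReal_mul, Real.mul_self_sqrt (Nat.cast_nonneg d)]
  simp

theorem star_inv_sqrt (d : ℕ) : star ((√d : ℝ) : ℂ)⁻¹ = ((√d : ℝ) : ℂ)⁻¹ := by simp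

theorem maxEnt_norm (hd : d ≠ 0) : star (maxEnt d) ⬝ᵥ maxEnt d = 1 := by
  have hd' : (d : ℂ) ≠ 0 := by exact_mod_cast hd
  have h : ∀ x : Fin d × Fin d, star (maxEnt d) x * maxEnt d x
      = if x.1 = x.2 then (d : ℂ)⁻¹ else 0 := by
    intro x
    rw [Pi.star_apply, maxEnt]
    split_ifs
    · rw [star_inv_sqrt, inv_sqrt_mul_inv_sqrt]
    · simp
  simp only [dotProduct, h, Fintype.sum_prod_type]
  simp [hd']

theorem isState_vecMulVec {ι : Type*} [Fintype ι] {ψ : ι → ℂ} (hψ : star ψ ⬝ᵥ ψ = 1) :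
    IsState (vecMulVec ψ (star ψ)) :=
  ⟨posSemidef_vecMulVec_self_star ψ, by rw [trace_vecMulVec, dotProduct_comm, hψ]⟩

theorem maxEnt_dotProduct_tensorMap (Φ : SuperOp (Fin d) (Fin d)) :
    star (maxEnt d) ⬝ᵥ (tensorMap Φ (LinearMap.id : SuperOp (Fin d) (Fin d))
      (vecMulVec (maxEnt d) (star (maxEnt d))) *ᵥ maxEnt d) = entFid Φ := by
  have hb : ∀ k l, block (vecMulVec (maxEnt d) (star (maxEnt d))) k l
      = (d : ℂ)⁻¹ • Matrix.single k l 1 := by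
    intro k l
    ext i j
    simp only [block, Matrix.of_apply, vecMulVec_apply, Pi.star_apply, maxEnt, Matrix.smul_apply,
      Matrix.single_apply, smul_eq_mul, eq_comm (a := k), eq_comm (a := l)]
    split_ifs <;> simp_all [← inv_sqrt_mul_inv_sqrt]
  have hR : ∀ f : Fin d × Fin d → ℂ, f ⬝ᵥ maxEnt d = ∑ j, f (j, j) * ((√d : ℝ) : ℂ)⁻¹ := fun f => by
    simp [dotProduct, Fintype.sum_prod_type, maxEnt]
  have hL : ∀ f : Fin d × Fin d → ℂ, star (maxEnt d) ⬝ᵥ f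
      = ∑ j, f (j, j) * ((√d : ℝ) : ℂ)⁻¹ := fun f => by
    rw [dotProduct_comm]
    simp [dotProduct, Fintype.sum_prod_type, maxEnt, apply_ite (starRingEnd ℂ)]
  simp only [hL, mulVec, hR, tensorMap_id_apply, hb, map_smul, Matrix.smul_apply, smul_eq_mul,
    Finset.sum_mul]
  rw [entFid, Finset.sum_div]
  refine Finset.sum_congr rfl fun i _ => ?_
  rw [Finset.sum_div]
  refine Finset.sum_congr rfl fun j _ => ?_
  have := inv_sqrt_mul_inv_sqrt d
  rw [div_eq_mul_inv, pow_two, mul_inv]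
  linear_combination (d : ℂ)⁻¹ * Φ (Matrix.single i j 1) i j * this

theorem isChannel_id {ι : Type*} [Fintype ι] :
    IsChannel (LinearMap.id : SuperOp ι ι) :=
  ⟨fun _ X hX => by rwa [tensorMap_id_id], fun _ => rfl⟩

theorem IsChannel.comp {ι ι' κ : Type*} [Fintype ι] [Fintype ι'] [Fintype κ] {Φ : SuperOp ι' κ}
    {Θ : SuperOp ι ι'} (hΦ : IsChannel Φ) (hΘ : IsChannel Θ) : IsChannel (Φ ∘ₗ Θ) :=
  ⟨hΦ.isCP.comp hΘ.isCP, fun X => by rw [LinearMap.comp_apply, hΦ.2, hΘ.2]⟩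

/-- Test the diamond norm on the maximally entangled state and bound the expectation of the
difference by its full trace norm. -/
theorem one_sub_entFid_le_epsWc (hd : d ≠ 0) {Φ : SuperOp (Fin d) (Fin d)} (hΦ : IsChannel Φ) :
    1 - (entFid Φ).re ≤ 2 * epsWc Φ LinearMap.id := by
  have hst := isState_vecMulVec (maxEnt_norm hd)
  have h1 := le_epsWc hΦ isChannel_id hst
  set ρ := vecMulVec (maxEnt d) (star (maxEnt d)) with hρ
  rw [tensorMap_id_id] at h1
  have h2 := re_dotProduct_mulVec_le_traceNorm
    (A := ρ - tensorMap Φ (LinearMap.id : SuperOp (Fin d) (Fin d)) ρ)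
    (hst.1.1.sub (hΦ.1 d ρ hst.1).1) (maxEnt_norm hd)
  rw [Matrix.sub_mulVec, dotProduct_sub, maxEnt_dotProduct_tensorMap, hρ, vecMulVec_mulVec,
    maxEnt_norm hd, MulOpposite.op_one, one_smul, maxEnt_norm hd, ← hρ,
    Complex.sub_re, Complex.one_re] at h2
  have h3 : ∀ A : Matrix (Fin d × Fin d) (Fin d × Fin d) ℂ, traceNorm (-A) = traceNorm A :=
    fun A => by simp [traceNorm]
  rw [← h3, neg_sub] at h2
  linarith

/-- The vector of `∑_b N_b ⊗ |b⟩` applied to the maximally entangled state. -/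
def krausVec {r : ℕ} (N : Fin r → Matrix π (Fin d) ℂ) : (π × Fin d) × Fin r → ℂ :=
  fun x => ((√d : ℝ) : ℂ)⁻¹ * N x.2 x.1.1 x.1.2

theorem sum_norm_sq_eq_trace {ι κ : Type*} [Fintype ι] [Fintype κ] (M : Matrix ι κ ℂ) :
    ((∑ i, ∑ j, ‖M i j‖ ^ 2 : ℝ) : ℂ) = (M * Mᴴ).trace := by
  simp only [Matrix.trace, Matrix.diag, Matrix.mul_apply, conjTranspose_apply, RCLike.star_def,
    Complex.mul_conj']
  push_cast; rfl

theorem norm_trace_sq_le (M : Matrix (Fin d) (Fin d) ℂ) :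
    ‖M.trace‖ ^ 2 ≤ d * ∑ i, ∑ j, ‖M i j‖ ^ 2 := by
  have h1 : ‖M.trace‖ ≤ ∑ i, ‖M i i‖ := norm_sum_le _ _
  have h2 : (∑ i, ‖M i i‖) ^ 2 ≤ d * ∑ i, ‖M i i‖ ^ 2 := by
    simpa using sq_sum_le_card_mul_sum_sq (s := Finset.univ) (f := fun i => ‖M i i‖)
  have h3 : ∑ i, ‖M i i‖ ^ 2 ≤ ∑ i, ∑ j, ‖M i j‖ ^ 2 :=
    Finset.sum_le_sum fun i _ =>
      Finset.single_le_sum (f := fun j => ‖M i j‖ ^ 2) (fun j _ => sq_nonneg _) (Finset.mem_univ i)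
  calc ‖M.trace‖ ^ 2 ≤ (∑ i, ‖M i i‖) ^ 2 := by gcongr
    _ ≤ _ := h2
    _ ≤ _ := by gcongr

/-- Trace preservation applied to the identity gives `∑ tr (N N†) = d`. -/
theorem krausVec_norm (hd : d ≠ 0) {r : ℕ} {N : Fin r → Matrix π (Fin d) ℂ}
    (hN : ∀ X, ((∑ b, conjMap (N b)) X).trace = X.trace) :
    star (krausVec N) ⬝ᵥ krausVec N = 1 := by
  have hd' : (d : ℂ) ≠ 0 := by exact_mod_cast hd
  have h1 : star (krausVec N) ⬝ᵥ krausVec N = (d : ℂ)⁻¹ * ∑ b, (N b * (N b)ᴴ).trace := by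
    simp only [dotProduct, Fintype.sum_prod_type, Pi.star_apply, krausVec, star_mul',
      star_inv_sqrt, Matrix.trace, Matrix.diag, Matrix.mul_apply, conjTranspose_apply]
    rw [Finset.mul_sum]
    simp only [Finset.mul_sum]
    simp only [Finset.sum_comm (t := (Finset.univ : Finset (Fin r)))]
    refine Finset.sum_congr rfl fun i _ => Finset.sum_congr rfl fun j _ =>
      Finset.sum_congr rfl fun b _ => ?_
    rw [← inv_sqrt_mul_inv_sqrt]
    ring
  have h2 := hN 1
  simp only [LinearMap.sum_apply, conjMap_apply, Matrix.mul_one, Matrix.trace_sum] at h2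
  rw [h1, h2]
  simp [hd']

/-- The linear map taking a tuple of matrices `φ_b` to the traces `tr (D_a φ_b) / √d`. -/
def decoderMap (r : ℕ) {s : ℕ} (D : Fin s → Matrix (Fin d) π ℂ) :
    EuclideanSpace ℂ ((π × Fin d) × Fin r) →ₗ[ℂ] EuclideanSpace ℂ (Fin s × Fin r) where
  toFun φ := WithLp.toLp 2 fun x => ((√d : ℝ) : ℂ)⁻¹ *
    (D x.1 * Matrix.of fun p l => φ ((p, l), x.2)).trace
  map_add' φ χ := by
    ext x
    have : (Matrix.of fun p l => (φ + χ) ((p, l), x.2))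
      = (Matrix.of fun p l => φ ((p, l), x.2)) + Matrix.of fun p l => χ ((p, l), x.2) := rfl
    change _ * (D x.1 * Matrix.of fun p l => (φ + χ) ((p, l), x.2)).trace = _ * _ + _ * _
    rw [this, Matrix.mul_add, Matrix.trace_add, mul_add]
  map_smul' c φ := by
    ext x
    have : (Matrix.of fun p l => (c • φ) ((p, l), x.2))
      = c • (Matrix.of fun p l => φ ((p, l), x.2)) := rfl
    change _ * (D x.1 * Matrix.of fun p l => (c • φ) ((p, l), x.2)).trace = c * (_ * _)
    rw [this, Matrix.mul_smul, Matrix.trace_smul, smul_eq_mul, mul_left_comm]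

/-- For each environment index, Cauchy–Schwarz on the diagonal gives `|tr X|² ≤ d ‖X‖²` in the
Hilbert–Schmidt norm, which absorbs the factor `1/√d`; trace preservation tested on `M M†` gives `∑ₐ
‖D_a M‖² = ‖M‖²`. -/
theorem norm_decoderMap_le (r : ℕ) {s : ℕ} {D : Fin s → Matrix (Fin d) π ℂ}
    (hD : ∀ X, ((∑ a, conjMap (D a)) X).trace = X.trace)
    (φ : EuclideanSpace ℂ ((π × Fin d) × Fin r)) : ‖decoderMap r D φ‖ ≤ ‖φ‖ := by
  refine (sq_le_sq₀ (norm_nonneg _) (norm_nonneg _)).mp ?_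
  rw [EuclideanSpace.norm_sq_eq, EuclideanSpace.norm_sq_eq, Fintype.sum_prod_type_right,
    Fintype.sum_prod_type_right]
  refine Finset.sum_le_sum fun b _ => ?_
  set M : Matrix π (Fin d) ℂ := Matrix.of fun p l => φ ((p, l), b) with hM
  have h1 : ∀ a, ‖decoderMap r D φ (a, b)‖ ^ 2 ≤ ∑ i, ∑ j, ‖(D a * M) i j‖ ^ 2 := by
    intro a
    change ‖((√d : ℝ) : ℂ)⁻¹ * (D a * M).trace‖ ^ 2 ≤ _
    rw [norm_mul, mul_pow, norm_inv, Complex.norm_real, inv_pow, Real.norm_eq_abs, sq_abs,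
      Real.sq_sqrt (Nat.cast_nonneg d)]
    rcases Nat.eq_zero_or_pos d with rfl | hd
    · simp
    · have hd' : (0 : ℝ) < d := by exact_mod_cast hd
      rw [inv_mul_le_iff₀ hd']
      exact norm_trace_sq_le _
  have h2 : ∑ a, ∑ i, ∑ j, ‖(D a * M) i j‖ ^ 2 = ∑ p, ∑ l, ‖M p l‖ ^ 2 := by
    have h3 : ((∑ a, ∑ i, ∑ j, ‖(D a * M) i j‖ ^ 2 : ℝ) : ℂ)
        = ((∑ p, ∑ l, ‖M p l‖ ^ 2 : ℝ) : ℂ) := by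
      rw [sum_norm_sq_eq_trace, ← hD, Complex.ofReal_sum, LinearMap.sum_apply, Matrix.trace_sum]
      refine Finset.sum_congr rfl fun a _ => ?_
      rw [sum_norm_sq_eq_trace, conjMap_apply, conjTranspose_mul]
      simp only [Matrix.mul_assoc]
    exact_mod_cast h3
  calc _ ≤ ∑ a, ∑ i, ∑ j, ‖(D a * M) i j‖ ^ 2 := Finset.sum_le_sum fun a _ => h1 a
    _ = _ := h2
    _ = _ := by rw [Fintype.sum_prod_type]; rfl

/-- Together with `entFid_comp_sum_conjMap`, this identifies the entanglement fidelity of decoder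
after noisy encoder with the squared norm of a contraction applied to the purified state. -/
theorem norm_decoderMap_krausVec_sq {r s : ℕ} (D : Fin s → Matrix (Fin d) π ℂ)
    (M : Fin r → Matrix π (Fin d) ℂ) :
    ‖decoderMap r D (WithLp.toLp 2 (krausVec M))‖ ^ 2
      = ∑ x : Fin s × Fin r, ‖(D x.1 * M x.2).trace‖ ^ 2 / (d : ℝ) ^ 2 := by
  rw [EuclideanSpace.norm_sq_eq]
  refine Finset.sum_congr rfl fun x _ => ?_
  have h : (Matrix.of fun p l => krausVec M ((p, l), x.2)) = ((√d : ℝ) : ℂ)⁻¹ • M x.2 := by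
    ext p l; rfl
  change ‖((√d : ℝ) : ℂ)⁻¹ * (D x.1 * Matrix.of fun p l => krausVec M ((p, l), x.2)).trace‖ ^ 2 = _
  rw [h, Matrix.mul_smul, Matrix.trace_smul, smul_eq_mul, ← mul_assoc, inv_sqrt_mul_inv_sqrt,
    norm_mul, mul_pow, norm_inv, Complex.norm_natCast, inv_pow]
  ring

theorem entFid_comp_sum_conjMap {r s : ℕ} (D : Fin s → Matrix (Fin d) π ℂ)
    (M : Fin r → Matrix π (Fin d) ℂ) :
    entFid ((∑ a, conjMap (D a)) ∘ₗ ∑ b, conjMap (M b))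
      = ((∑ x : Fin s × Fin r, ‖(D x.1 * M x.2).trace‖ ^ 2 / (d : ℝ) ^ 2 : ℝ) : ℂ) := by
  rw [← entFid_sum_conjMap fun x : Fin s × Fin r => D x.1 * M x.2]
  congr 1
  ext1 X
  simp only [LinearMap.comp_apply, LinearMap.sum_apply, map_sum, Fintype.sum_prod_type,
    conjMap_apply, conjTranspose_mul, Matrix.mul_assoc]
  rw [Finset.sum_comm]

theorem entFid_haarMap {F : SU d → SuperOp (Fin d) (Fin d)}
    (hF : ∀ X, Continuous fun U => F U X) :
    entFid (haarMap F) = ∫ U, entFid (F U) ∂haarSU d := by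
  have hint : ∀ i j, Integrable (fun U => F U (Matrix.single i j 1) i j) (haarSU d) := fun i j =>
    integrable_haarSU ((hF _).matrix_elem i j)
  simp only [entFid, haarMap_apply hF]
  rw [integral_div, integral_finsetSum _ fun i _ => integrable_finsetSum _ fun j _ => hint i j]
  refine congrArg (· / _) (Finset.sum_congr rfl fun i _ => ?_)
  rw [integral_finsetSum _ fun j _ => hint i j]
  rfl

/-- The action `U^{⊗ n} ⊗ U^* ⊗ I`. -/
def actPurified (n r : ℕ) (U : SU d) :
    Matrix ((Qudits d n × Fin d) × Fin r) ((Qudits d n × Fin d) × Fin r) ℂ :=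
  (actQ n U ⊗ₖ (U : Matrix (Fin d) (Fin d) ℂ).map star) ⊗ₖ (1 : Matrix (Fin r) (Fin r) ℂ)

theorem continuous_actQ_kronecker_star (n : ℕ) : Continuous fun U : SU d =>
    actQ n U ⊗ₖ (U : Matrix (Fin d) (Fin d) ℂ).map star :=
  continuous_matrix fun a b => ((continuous_actQ n).matrix_elem a.1 b.1).mul
    (continuous_coe_SU.matrix_elem a.2 b.2).star

theorem continuous_actPurified (n r : ℕ) : Continuous (actPurified n r : SU d → _) :=
  continuous_matrix fun a b =>
    ((continuous_actQ_kronecker_star n).matrix_elem a.1 b.1).mul continuous_const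

/-- The transpose trick: on the maximally entangled state, right multiplication by `U` is the action
of `Uᵀ = (U^*)†` on the reference. -/
theorem conjTranspose_actPurified_mulVec {n r : ℕ} (N : Fin r → Matrix (Qudits d n) (Fin d) ℂ)
    (U : SU d) : (actPurified n r U)ᴴ *ᵥ krausVec N
      = krausVec fun b => (actQ n U)ᴴ * N b * (U : Matrix (Fin d) (Fin d) ℂ) := by
  ext ⟨⟨p, l⟩, b⟩
  simp only [mulVec, dotProduct, actPurified, Fintype.sum_prod_type, conjTranspose_apply,
    kroneckerMap_apply, Matrix.one_apply, krausVec, Matrix.mul_apply, Matrix.map_apply, star_mul',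
    star_star, Finset.sum_mul, Finset.mul_sum]
  rw [Finset.sum_comm]
  refine Finset.sum_congr rfl fun l' _ => Finset.sum_congr rfl fun p' _ => ?_
  simp [apply_ite (starRingEnd ℂ)]
  ring

theorem conjMap_vecMulVec {ι κ : Type*} [Fintype ι] (A : Matrix κ ι ℂ) (ψ : ι → ℂ) :
    conjMap A (vecMulVec ψ (star ψ)) = vecMulVec (A *ᵥ ψ) (star (A *ᵥ ψ)) := by
  rw [conjMap_apply, mul_vecMulVec, vecMulVec_mul, star_mulVec]

/-- The pure state `ψ`, with the environment as reference system, is one admissible input. The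
second channel is the identity, so the fidelity is an expectation value in `ψ`. -/
theorem frameFidelity_le {n r : ℕ} {q : SU d → ℝ} (hq : Continuous q) (hq0 : ∀ U, 0 ≤ q U)
    {ψ : (Qudits d n × Fin d) × Fin r → ℂ} (hψ : star ψ ⬝ᵥ ψ = 1) :
    frameFidelity n (fun U => (q U : ℂ))
      ≤ ∫ U, q U * ‖star ψ ⬝ᵥ ((actPurified n r U)ᴴ *ᵥ ψ)‖ ^ 2 ∂haarSU d := by
  refine (Fwc_le (isState_vecMulVec hψ)).trans_eq ?_
  have hqc : Continuous fun U => (q U : ℂ) := Complex.continuous_ofReal.comp hq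
  have hA : Continuous fun U : SU d => (q U : ℂ) • conjMap (actPurified n r U)
      (vecMulVec ψ (star ψ)) :=
    hqc.smul (continuous_conjMap (continuous_actPurified n r) continuous_const)
  have h1 : tensorMap (haarMap fun U : SU d =>
      (q U : ℂ) • conjMap (actQ n U ⊗ₖ (U : Matrix (Fin d) (Fin d) ℂ).map star))
      (LinearMap.id : SuperOp (Fin r) (Fin r)) (vecMulVec ψ (star ψ))
      = haarMat fun U => (q U : ℂ) • conjMap (actPurified n r U) (vecMulVec ψ (star ψ)) := by
    rw [tensorMap_haarMap]
    · refine congrArg haarMat (funext fun U => ?_)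
      rw [tensorMap_smul_id, tensorMap_conjMap_id]
      rfl
    · intro X
      exact hqc.smul (continuous_conjMap (continuous_actQ_kronecker_star n) continuous_const)
  rw [h1, tensorMap_id_id, fidelity_vecMulVec]
  · let ℓ : Matrix ((Qudits d n × Fin d) × Fin r) ((Qudits d n × Fin d) × Fin r) ℂ →ₗ[ℂ] ℂ :=
      { toFun := fun A => star ψ ⬝ᵥ (A *ᵥ ψ)
        map_add' := fun A B => by rw [Matrix.add_mulVec, dotProduct_add]
        map_smul' := fun c A => by rw [Matrix.smul_mulVec, dotProduct_smul]; rfl }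
    have h2 := haarMat_functional hA ℓ
    change (ℓ _).re = _
    have h3 : ∀ U, ℓ ((q U : ℂ) • conjMap (actPurified n r U) (vecMulVec ψ (star ψ)))
        = ((q U * ‖star ψ ⬝ᵥ ((actPurified n r U)ᴴ *ᵥ ψ)‖ ^ 2 : ℝ) : ℂ) := by
      intro U
      rw [map_smul, conjMap_vecMulVec]
      change (q U : ℂ) * (star ψ ⬝ᵥ (vecMulVec _ _ *ᵥ ψ)) = _
      have e1 : star (actPurified n r U *ᵥ ψ) ⬝ᵥ ψ
          = star ψ ⬝ᵥ ((actPurified n r U)ᴴ *ᵥ ψ) := by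
        rw [star_mulVec, ← dotProduct_mulVec]
      have e2 : star ψ ⬝ᵥ (actPurified n r U *ᵥ ψ)
          = star (star ψ ⬝ᵥ ((actPurified n r U)ᴴ *ᵥ ψ)) := by
        rw [← e1, star_dotProduct]
      rw [vecMulVec_mulVec, e1, dotProduct_smul, e2]
      change (q U : ℂ) * (_ * _) = _
      rw [MulOpposite.unop_op, RCLike.star_def, Complex.conj_mul']
      push_cast
      rfl
    rw [h2, integral_congr_ae (Filter.Eventually.of_forall h3)]
    erw [integral_ofReal]
    rfl
  · refine haarMat_posSemidef hA fun U => ?_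
    exact (conjMap_posSemidef _ (posSemidef_vecMulVec_self_star ψ)).smul
      (Complex.zero_le_real.mpr (hq0 U))

/-- The noisy code with decoder rotated by a random group element with density `q`. -/
def rotatedCode {n : ℕ} (q : SU d → ℝ) (D : SuperOp (Qudits d n) (Fin d))
    (N : SuperOp (Fin d) (Qudits d n)) : SuperOp (Fin d) (Fin d) :=
  haarMap fun U : SU d => (q U : ℂ) • (conjMap (U : Matrix (Fin d) (Fin d) ℂ) ∘ₗ D
    ∘ₗ conjMap (actQ n U⁻¹) ∘ₗ N)

theorem continuous_rotatedCode_integrand {n : ℕ} {q : SU d → ℝ} (hq : Continuous q)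
    (D : SuperOp (Qudits d n) (Fin d)) (N : SuperOp (Fin d) (Qudits d n))
    (X : Matrix (Fin d) (Fin d) ℂ) :
    Continuous fun U : SU d => ((q U : ℂ) • (conjMap (U : Matrix (Fin d) (Fin d) ℂ) ∘ₗ D
      ∘ₗ conjMap (actQ n U⁻¹) ∘ₗ N)) X :=
  (Complex.continuous_ofReal.comp hq).smul (continuous_conjMap continuous_coe_SU
    (continuous_linearMap_apply
      (continuous_conjMap ((continuous_actQ n).comp continuous_inv) continuous_const) D))

/-- For each `U` the contraction inequality compares the purified state with its rotated copy; the
result is then averaged with weight `q`. -/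
theorem one_sub_entFid_rotatedCode_le (hd : d ≠ 0) {n : ℕ} {q : SU d → ℝ} (hq : Continuous q)
    (hq0 : ∀ U, 0 ≤ q U) (hq1 : ∫ U, q U ∂haarSU d ≤ 1) {D : SuperOp (Qudits d n) (Fin d)}
    {N : SuperOp (Fin d) (Qudits d n)} (hD : IsChannel D) (hN : IsChannel N) :
    1 - (entFid (rotatedCode q D N)).re
      ≤ 4 * epsWc (D ∘ₗ N) LinearMap.id + 2 * (1 - frameFidelity n fun U => (q U : ℂ)) := by
  have hDN := one_sub_entFid_le_epsWc hd (hD.comp hN)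
  obtain ⟨s, K, rfl⟩ := hD.isCP.exists_kraus
  obtain ⟨r, M, rfl⟩ := hN.isCP.exists_kraus
  let T : SU d → Fin r → Matrix (Qudits d n) (Fin d) ℂ := fun U b =>
    (actQ n U)ᴴ * M b * (U : Matrix (Fin d) (Fin d) ℂ)
  have hTc : ∀ b, Continuous fun U => T U b := fun b =>
    ((continuous_actQ n).matrix_conjTranspose.matrix_mul continuous_const).matrix_mul
      continuous_coe_SU
  let w : SU d → ℝ := fun U => ∑ x : Fin s × Fin r, ‖(K x.1 * T U x.2).trace‖ ^ 2 / (d : ℝ) ^ 2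
  have hw : Continuous w := continuous_finsetSum _ fun x _ =>
    (((continuous_const.matrix_mul (hTc x.2)).matrix_trace.norm).pow 2).div_const _
  have hMn := krausVec_norm hd hN.2
  let c : SU d → ℝ := fun U => ‖star (krausVec M) ⬝ᵥ ((actPurified n r U)ᴴ *ᵥ krausVec M)‖ ^ 2
  have hc : Continuous c :=
    ((continuous_const.dotProduct ((continuous_actPurified n r).matrix_conjTranspose.matrix_mulVec
      continuous_const)).norm).pow 2
  have hF : frameFidelity n (fun U => (q U : ℂ)) ≤ ∫ U, q U * c U ∂haarSU d :=
    frameFidelity_le hq hq0 hMn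
  have hent : (entFid (rotatedCode q (∑ a, conjMap (K a)) (∑ b, conjMap (M b)))).re
      = ∫ U, q U * w U ∂haarSU d := by
    have h1 : ∀ U : SU d, entFid ((q U : ℂ) • (conjMap (U : Matrix (Fin d) (Fin d) ℂ)
        ∘ₗ (∑ a, conjMap (K a)) ∘ₗ conjMap (actQ n U⁻¹) ∘ₗ ∑ b, conjMap (M b)))
        = ((q U * w U : ℝ) : ℂ) := by
      intro U
      have h2 : conjMap (U : Matrix (Fin d) (Fin d) ℂ)
          ∘ₗ (∑ a, conjMap (K a)) ∘ₗ conjMap (actQ n U⁻¹) ∘ₗ ∑ b, conjMap (M b)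
          = (∑ a, conjMap ((U : Matrix (Fin d) (Fin d) ℂ) * K a))
            ∘ₗ ∑ b, conjMap ((actQ n U)ᴴ * M b) := by
        ext1 X
        simp only [LinearMap.comp_apply, LinearMap.sum_apply, map_sum, conjMap_apply,
          conjTranspose_mul, Matrix.mul_assoc, actQ_inv]
      have h3 : ∀ (r : ℂ) (Φ : SuperOp (Fin d) (Fin d)), entFid (r • Φ) = r * entFid Φ := by
        intro r Φ
        simp only [entFid, LinearMap.smul_apply, Matrix.smul_apply, smul_eq_mul, ← Finset.mul_sum]
        ring
      rw [h3, h2, entFid_comp_sum_conjMap]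
      push_cast
      congr 1
      simp only [w, T]
      push_cast
      refine Finset.sum_congr rfl fun x _ => ?_
      -- Cyclicity moves the correction `U` from the left of the decoder to the right of the
      -- encoder.
      rw [Matrix.mul_assoc, Matrix.trace_mul_comm]
      simp only [Matrix.mul_assoc]
    rw [rotatedCode, entFid_haarMap (continuous_rotatedCode_integrand hq _ _),
      integral_congr_ae (Filter.Eventually.of_forall h1)]
    erw [integral_ofReal]
    rfl
  set e : ℝ := (entFid ((∑ a, conjMap (K a)) ∘ₗ ∑ b, conjMap (M b))).re with he
  have he' : e = ‖decoderMap r K (WithLp.toLp 2 (krausVec M))‖ ^ 2 := by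
    rw [he, entFid_comp_sum_conjMap, Complex.ofReal_re, norm_decoderMap_krausVec_sq]
  have hnorm : ∀ {M' : Fin r → Matrix (Qudits d n) (Fin d) ℂ},
      star (krausVec M') ⬝ᵥ krausVec M' = 1 → ‖WithLp.toLp 2 (krausVec M')‖ = 1 := by
    intro M' h
    rw [dotProduct_star_self_eq] at h
    rw [EuclideanSpace.norm_eq]
    have : ∑ i, ‖krausVec M' i‖ ^ 2 = 1 := by exact_mod_cast h
    simp only [this, Real.sqrt_one]
  have hpt : ∀ U, 1 - w U ≤ 2 * (1 - e) + 2 * (1 - c U) := by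
    intro U
    have hT : star (krausVec (T U)) ⬝ᵥ krausVec (T U) = 1 := by
      refine krausVec_norm hd fun X => ?_
      have h4 : ∑ b, conjMap (T U b) = conjMap (actQ n U)ᴴ ∘ₗ (∑ b, conjMap (M b))
          ∘ₗ conjMap (U : Matrix (Fin d) (Fin d) ℂ) := by
        ext1 X
        simp only [T, LinearMap.comp_apply, LinearMap.sum_apply, map_sum, conjMap_apply,
          conjTranspose_mul, Matrix.mul_assoc]
      rw [h4, LinearMap.comp_apply, conjMap_trace, LinearMap.comp_apply, hN.2,
        conjMap_trace (SU_conjTranspose_mul U)]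
      rw [conjTranspose_conjTranspose, actQ_mul_conjTranspose]
    have h5 := one_sub_norm_sq_le (decoderMap r K) (norm_decoderMap_le r hD.2) (hnorm hMn)
      (hnorm hT)
    rw [norm_decoderMap_krausVec_sq K (T U), ← he'] at h5
    have h6 : inner ℂ (WithLp.toLp 2 (krausVec M)) (WithLp.toLp 2 (krausVec (T U)))
        = star (krausVec M) ⬝ᵥ ((actPurified n r U)ᴴ *ᵥ krausVec M) := by
      rw [conjTranspose_actPurified_mulVec, EuclideanSpace.inner_eq_star_dotProduct,
        dotProduct_comm]
    rw [h6] at h5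
    exact h5
  have he1 : e ≤ 1 := by
    rw [he']
    refine pow_le_one₀ (norm_nonneg _) ?_
    rw [← hnorm hMn]
    exact norm_decoderMap_le r hD.2 _
  have hint1 : Integrable (fun U => q U * w U) (haarSU d) := integrable_haarSU (hq.mul hw)
  have hint2 : Integrable (fun U => q U * c U) (haarSU d) := integrable_haarSU (hq.mul hc)
  have hint3 : Integrable q (haarSU d) := integrable_haarSU hq
  -- The pointwise bound solved for `w`, times `q`. The constant stays attached to `q`, whose total
  -- mass may be below 1.
  have hmain : ∫ U, (2 * (q U * c U) - (3 - 2 * e) * q U) ∂haarSU d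
      ≤ ∫ U, q U * w U ∂haarSU d := by
    refine integral_mono ((hint2.const_mul 2).sub (hint3.const_mul _)) hint1 fun U => ?_
    have := mul_le_mul_of_nonneg_left (hpt U) (hq0 U)
    change 2 * (q U * c U) - (3 - 2 * e) * q U ≤ q U * w U
    linarith
  rw [integral_sub (hint2.const_mul 2) (hint3.const_mul _), integral_const_mul,
    integral_const_mul] at hmain
  -- Needs `3 - 2 e ≥ 0`, which is why `e ≤ 1` was shown.
  have hlast : (3 - 2 * e) * ∫ U, q U ∂haarSU d ≤ (3 - 2 * e) * 1 :=
    mul_le_mul_of_nonneg_left hq1 (by linarith)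
  rw [hent]
  linarith

end EntanglementFidelity

/-! ### The error-tolerant measurement -/

theorem trace_mul_one_kronecker {α β : Type*} [Fintype α] [DecidableEq α] [Fintype β]
    (Y : Matrix (α × β) (α × β) ℂ) (B : Matrix β β ℂ) :
    (Y * ((1 : Matrix α α ℂ) ⊗ₖ B)).trace
      = ∑ e, (Y.submatrix (fun a => (e, a)) (fun a => (e, a)) * B).trace := by
  simp only [Matrix.trace, Matrix.diag, Matrix.mul_apply, Fintype.sum_prod_type,
    kroneckerMap_apply, Matrix.one_apply]
  refine Finset.sum_congr rfl fun e _ => Finset.sum_congr rfl fun a _ => ?_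
  simp only [ite_mul, one_mul, zero_mul, mul_ite, mul_zero]
  rw [Finset.sum_comm]
  simp

/-- The effect is the identity on the first factor, so the unitary `w` there cancels. This is why
the representation on the error spaces can be arbitrary. -/
theorem trace_conjMap_kronecker_mul {α β : Type*} [Fintype α] [DecidableEq α] [Fintype β]
    [DecidableEq β] {w : Matrix α α ℂ} {g : Matrix β β ℂ} (hw : wᴴ * w = 1) (hg : gᴴ * g = 1)
    (Y : Matrix (α × β) (α × β) ℂ) (B : Matrix β β ℂ) :
    (conjMap (w ⊗ₖ g) Y * ((1 : Matrix α α ℂ) ⊗ₖ conjMap g B)).trace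
      = (Y * ((1 : Matrix α α ℂ) ⊗ₖ B)).trace := by
  have h3 : (w ⊗ₖ g)ᴴ * ((1 : Matrix α α ℂ) ⊗ₖ (g * B * gᴴ)) * (w ⊗ₖ g)
      = (1 : Matrix α α ℂ) ⊗ₖ B := by
    rw [conjTranspose_kronecker, ← Matrix.mul_kronecker_mul, ← Matrix.mul_kronecker_mul,
      Matrix.mul_one, hw]
    congr 1
    calc gᴴ * (g * B * gᴴ) * g = (gᴴ * g) * B * (gᴴ * g) := by simp only [Matrix.mul_assoc]
      _ = B := by rw [hg, Matrix.one_mul, Matrix.mul_one]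
  rw [← h3, conjMap_apply, conjMap_apply, Matrix.mul_assoc, Matrix.mul_assoc (w ⊗ₖ g),
    Matrix.trace_mul_comm]
  simp only [Matrix.mul_assoc]

theorem integral_sum_sum_le {d : ℕ} {S : Type*} [Fintype S] {T : S → Type*} [∀ s, Fintype (T s)]
    {f : ∀ s, T s → SU d → ℝ} (hf : ∀ s e, Continuous (f s e)) {c : ∀ s, T s → ℝ}
    (h : ∀ s e, ∫ U, f s e U ∂haarSU d ≤ c s e) :
    ∫ U, ∑ s, ∑ e, f s e U ∂haarSU d ≤ ∑ s, ∑ e, c s e := by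
  have hint := fun s e => integrable_haarSU (hf s e)
  rw [integral_finsetSum _ fun s _ => integrable_finsetSum _ fun e _ => hint s e]
  refine Finset.sum_le_sum fun s _ => ?_
  rw [integral_finsetSum _ fun e _ => hint s e]
  exact Finset.sum_le_sum fun e _ => h s e

section Measurement

variable {d m sR : ℕ} {Er : Fin sR → Type*} [∀ k, Fintype (Er k)] [∀ k, DecidableEq (Er k)]

/-- The basis vector `place s e a` as a function of the pair `(e, a)`. -/
def placePair (s : Finset (Fin sR))
    (x : (∀ k : {k // k ∉ s}, Er k) × Frames d m {k // k ∈ s}) : NoisyFrames d m Er :=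
  place s x.1 x.2

omit [∀ k, Fintype (Er k)] [∀ k, DecidableEq (Er k)] in
theorem placePair_apply_mem {s : Finset (Fin sR)}
    (x : (∀ k : {k // k ∉ s}, Er k) × Frames d m {k // k ∈ s}) {k : Fin sR} (h : k ∈ s) :
    placePair s x k = Sum.inl (x.2 ⟨k, h⟩) := dif_pos h

omit [∀ k, Fintype (Er k)] [∀ k, DecidableEq (Er k)] in
theorem placePair_apply_notMem {s : Finset (Fin sR)}
    (x : (∀ k : {k // k ∉ s}, Er k) × Frames d m {k // k ∈ s}) {k : Fin sR} (h : k ∉ s) :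
    placePair s x k = Sum.inr (x.1 ⟨k, h⟩) := dif_neg h

omit [∀ k, Fintype (Er k)] [∀ k, DecidableEq (Er k)] in
theorem placePair_injective (s : Finset (Fin sR)) :
    Function.Injective (placePair (d := d) (m := m) (Er := Er) s) := by
  rintro ⟨e, a⟩ ⟨e', a'⟩ h
  refine Prod.ext (funext fun k => ?_) (funext fun k => ?_)
  · have := congrFun h k.1
    rw [placePair_apply_notMem _ k.2, placePair_apply_notMem _ k.2] at this
    exact Sum.inr_injective this
  · have := congrFun h k.1
    rw [placePair_apply_mem _ k.2, placePair_apply_mem _ k.2] at this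
    exact Sum.inl_injective this

variable (d m Er) in
/-- The restriction to the frames with labels in `s` in their original spaces and the others in
their error spaces. -/
def restrictPattern (s : Finset (Fin sR)) :
    Matrix ((∀ k : {k // k ∉ s}, Er k) × Frames d m {k // k ∈ s}) (NoisyFrames d m Er) ℂ :=
  (1 : Matrix (NoisyFrames d m Er) (NoisyFrames d m Er) ℂ).submatrix (placePair s) id

theorem submatrix_placePair (s : Finset (Fin sR))
    (X : Matrix (NoisyFrames d m Er) (NoisyFrames d m Er) ℂ) :
    X.submatrix (placePair s) (placePair s) = conjMap (restrictPattern d m Er s) X := by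
  ext x y
  simp [conjMap_apply, restrictPattern, Matrix.mul_apply, Matrix.one_apply]

theorem actFrames_conjTranspose_mul (K : Type*) [Fintype K] [DecidableEq K] (V : SU d) :
    (actFrames m K V)ᴴ * actFrames m K V = 1 := by
  have h1 : ∀ V : SU d, (actFrame m V)ᴴ * actFrame m V = 1 := fun V => by
    rw [actFrame, conjTranspose_kronecker, ← Matrix.mul_kronecker_mul, actQ_conjTranspose_mul,
      conjTranspose_one, Matrix.one_mul, Matrix.one_kronecker_one]
  rw [actFrames, piKron_conjTranspose, piKron_mul]
  simp only [h1]
  exact piKron_one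

/-- The action on the error spaces of the frames with labels outside `s`. -/
def actErr (W : ∀ k, SU d →* Matrix.unitaryGroup (Er k) ℂ) (s : Finset (Fin sR)) (V : SU d) :
    Matrix (∀ k : {k // k ∉ s}, Er k) (∀ k : {k // k ∉ s}, Er k) ℂ :=
  piKron fun k => (W k V : Matrix (Er k) (Er k) ℂ)

theorem actErr_conjTranspose_mul (W : ∀ k, SU d →* Matrix.unitaryGroup (Er k) ℂ)
    (s : Finset (Fin sR)) (V : SU d) : (actErr W s V)ᴴ * actErr W s V = 1 := by
  rw [actErr, piKron_conjTranspose, piKron_mul, ← piKron_one]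
  congr 1
  funext k
  exact (Matrix.mem_unitaryGroup_iff'.mp (W k V).2)

/-- The action is block diagonal on each enlarged frame, so it preserves the pattern of frames found
in their error spaces. -/
theorem restrictPattern_mul_actNoisy (W : ∀ k, SU d →* Matrix.unitaryGroup (Er k) ℂ)
    (s : Finset (Fin sR)) (V : SU d) :
    restrictPattern d m Er s * actNoisy (m := m) W V
      = (actErr W s V ⊗ₖ actFrames m {k // k ∈ s} V) * restrictPattern d m Er s := by
  ext x y
  have hL : (restrictPattern d m Er s * actNoisy (m := m) W V) x y = actNoisy (m := m) W V (placePair s x) y := by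
    simp [restrictPattern, Matrix.mul_apply, Matrix.one_apply]
  have hR : ((actErr W s V ⊗ₖ actFrames m {k // k ∈ s} V) * restrictPattern d m Er s) x y
      = ∑ z, if placePair s z = y then (actErr W s V ⊗ₖ actFrames m {k // k ∈ s} V) x z else 0 := by
    simp [restrictPattern, Matrix.mul_apply, Matrix.one_apply]
  rw [hL, hR]
  by_cases hy : ∃ z, placePair s z = y
  · obtain ⟨z, rfl⟩ := hy
    simp only [(placePair_injective s).eq_iff, Finset.sum_ite_eq', Finset.mem_univ, if_true]
    change (∏ k, Matrix.fromBlocks (actFrame m V) 0 0 (W k V : Matrix (Er k) (Er k) ℂ)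
      (placePair s x k) (placePair s z k)) = _ * _
    rw [← Fintype.prod_subtype_mul_prod_subtype (fun k => k ∈ s), mul_comm]
    refine congrArg₂ (· * ·) ?_ ?_
    · refine Fintype.prod_equiv (Equiv.refl _) _ _ fun k => ?_
      rw [placePair_apply_notMem _ k.2, placePair_apply_notMem _ k.2]
      rfl
    · refine @Fintype.prod_equiv _ _ _ (_) (_) _ (Equiv.refl _) _ _ fun k => ?_
      rw [placePair_apply_mem _ k.2, placePair_apply_mem _ k.2]
      rfl
  · rw [Finset.sum_eq_zero fun z _ => if_neg fun h => hy ⟨z, h⟩]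
    -- A basis vector with another pattern differs from `s` at some frame, and there the matrix
    -- entry lies in a zero block.
    have : ∃ k, (k ∈ s ∧ (y k).isRight) ∨ (k ∉ s ∧ (y k).isLeft) := by
      by_contra! hcon
      refine hy ⟨(fun k => (y k).getRight (by simpa using (hcon k).2 k.2),
        fun k => (y k).getLeft (by simpa using (hcon k).1 k.2)), ?_⟩
      funext k
      by_cases hk : k ∈ s
      · rw [placePair_apply_mem _ hk]; simp
      · rw [placePair_apply_notMem _ hk]; simp
    obtain ⟨k, hk⟩ := this
    refine Finset.prod_eq_zero (Finset.mem_univ k) ?_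
    rcases hk with ⟨hk, hy⟩ | ⟨hk, hy⟩
    · obtain ⟨z, hz⟩ := Sum.isRight_iff.mp hy
      rw [placePair_apply_mem _ hk, hz]; rfl
    · obtain ⟨z, hz⟩ := Sum.isLeft_iff.mp hy
      rw [placePair_apply_notMem _ hk, hz]; rfl

variable (Ξ : ∀ s : Finset (Fin sR),
  Matrix (Frames d m {k // k ∈ s}) (Frames d m {k // k ∈ s}) ℂ)

omit [∀ k, DecidableEq (Er k)] in
theorem errTolMeas_eq_sum (U : SU d)
    (X : Matrix (NoisyFrames d m Er) (NoisyFrames d m Er) ℂ) :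
    errTolMeas Ξ U X = ∑ s, ∑ e : (∀ k : {k // k ∉ s}, Er k),
      (X.submatrix (place s e) (place s e) * conjMap (actFrames m _ U) (Ξ s)).trace := rfl

theorem errTolMeas_apply (U : SU d) (X : Matrix (NoisyFrames d m Er) (NoisyFrames d m Er) ℂ) :
    errTolMeas Ξ U X = ∑ s, (conjMap (restrictPattern d m Er s) X
      * ((1 : Matrix (∀ k : {k // k ∉ s}, Er k) _ ℂ) ⊗ₖ conjMap (actFrames m _ U) (Ξ s))).trace := by
  rw [errTolMeas_eq_sum]
  refine Finset.sum_congr rfl fun s _ => ?_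
  rw [← submatrix_placePair, trace_mul_one_kronecker]
  rfl

/-- Covariance holds pattern by pattern: the surviving frames rotate with their effect, and the
error spaces contribute unitaries that cancel. -/
theorem errTolMeas_conjMap_actNoisy (W : ∀ k, SU d →* Matrix.unitaryGroup (Er k) ℂ) (U V : SU d)
    (X : Matrix (NoisyFrames d m Er) (NoisyFrames d m Er) ℂ) :
    errTolMeas Ξ (V * U) (conjMap (actNoisy (m := m) W V) X) = errTolMeas Ξ U X := by
  rw [errTolMeas_apply, errTolMeas_apply]
  refine Finset.sum_congr rfl fun s _ => ?_
  rw [actFrames_mul, ← conjMap_comp, LinearMap.comp_apply,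
    ← LinearMap.comp_apply (conjMap (restrictPattern d m Er s)), conjMap_comp,
    restrictPattern_mul_actNoisy, ← conjMap_comp, LinearMap.comp_apply]
  exact trace_conjMap_kronecker_mul (actErr_conjTranspose_mul W s V)
    (actFrames_conjTranspose_mul _ V) _ _

omit [∀ k, DecidableEq (Er k)] in
theorem continuous_errTolMeas (X : Matrix (NoisyFrames d m Er) (NoisyFrames d m Er) ℂ) :
    Continuous fun U => errTolMeas Ξ U X := by
  simp only [errTolMeas_eq_sum]
  exact continuous_finsetSum _ fun s _ => continuous_finsetSum _ fun _ _ =>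
    (continuous_const.matrix_mul
      (continuous_conjMap (continuous_actFrames _) continuous_const)).matrix_trace

variable {Ξ}

omit [∀ k, DecidableEq (Er k)] in
theorem errTolMeas_nonneg (hΞ : ∀ s, (Ξ s).PosSemidef)
    {X : Matrix (NoisyFrames d m Er) (NoisyFrames d m Er) ℂ} (hX : X.PosSemidef) (U : SU d) :
    0 ≤ errTolMeas Ξ U X :=
  Finset.sum_nonneg fun s _ => Finset.sum_nonneg fun _ _ =>
    trace_mul_nonneg (hX.submatrix _) (conjMap_posSemidef _ (hΞ s))

-- Different patterns label disjoint sets of basis vectors, namely fibres of the map that records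
-- which frames are in their original spaces.
omit [∀ k, DecidableEq (Er k)] in
theorem sum_placePair_le {f : NoisyFrames d m Er → ℝ} (hf : ∀ y, 0 ≤ f y) :
    ∑ s, ∑ x, f (placePair s x) ≤ ∑ y, f y := by
  classical
  let pat : NoisyFrames d m Er → Finset (Fin sR) := fun y =>
    Finset.univ.filter fun k => (y k).isLeft
  rw [← Finset.sum_fiberwise Finset.univ pat f]
  refine Finset.sum_le_sum fun s _ => ?_
  rw [← Finset.sum_image (f := f) (s := Finset.univ) (g := placePair s)
    fun x _ y _ h => placePair_injective s h]
  refine Finset.sum_le_sum_of_subset_of_nonneg (fun y hy => ?_) fun y _ _ => hf y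
  obtain ⟨x, -, rfl⟩ := Finset.mem_image.mp hy
  refine Finset.mem_filter.mpr ⟨Finset.mem_univ _, ?_⟩
  ext k
  by_cases hk : k ∈ s
  · simp [pat, placePair_apply_mem x hk, hk]
  · simp [pat, placePair_apply_notMem x hk, hk]

theorem integral_trace_mul_conjMap_le {K : Type*} [Fintype K] [DecidableEq K]
    {Θ : Matrix (Frames d m K) (Frames d m K) ℂ} (hΘ : IsCovariantPOVM Θ)
    {Y : Matrix (Frames d m K) (Frames d m K) ℂ} (hY : Y.PosSemidef) :
    ∫ U : SU d, (Y * conjMap (actFrames m K U) Θ).trace.re ∂haarSU d ≤ Y.trace.re := by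
  have hB : Continuous fun U : SU d => conjMap (actFrames m K U) Θ :=
    continuous_conjMap (continuous_actFrames _) continuous_const
  have h2 := haarMat_functional hB (Matrix.traceLinearMap _ ℂ ℂ ∘ₗ LinearMap.mulLeft ℂ Y)
  have h3 := (Complex.le_def.mp (trace_mul_nonneg hY hΘ.2)).1
  rw [Matrix.mul_sub, Matrix.mul_one, Matrix.trace_sub, Complex.sub_re, Complex.zero_re] at h3
  have h4 : ∫ U : SU d, (Y * conjMap (actFrames m K U) Θ).trace.re ∂haarSU d
      = (∫ U : SU d, (Y * conjMap (actFrames m K U) Θ).trace ∂haarSU d).re :=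
    integral_re (integrable_haarSU (continuous_const.matrix_mul hB).matrix_trace)
  have h5 : (Y * haarMat fun U : SU d => conjMap (actFrames m K U) Θ).trace
      = ∫ U : SU d, (Y * conjMap (actFrames m K U) Θ).trace ∂haarSU d := h2
  rw [h4, ← h5]
  linarith

omit [∀ k, DecidableEq (Er k)] in
theorem re_errTolMeas (U : SU d) (X : Matrix (NoisyFrames d m Er) (NoisyFrames d m Er) ℂ) :
    (errTolMeas Ξ U X).re = ∑ s, ∑ e : (∀ k : {k // k ∉ s}, Er k),
      (X.submatrix (place s e) (place s e) * conjMap (actFrames m _ U) (Ξ s)).trace.re := by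
  simp only [errTolMeas_eq_sum, Complex.re_sum]

omit [∀ k, DecidableEq (Er k)] in
theorem sum_trace_submatrix_place (s : Finset (Fin sR))
    (X : Matrix (NoisyFrames d m Er) (NoisyFrames d m Er) ℂ) :
    ∑ e : (∀ k : {k // k ∉ s}, Er k), (X.submatrix (place s e) (place s e)).trace.re
      = ∑ x, (X (placePair s x) (placePair s x)).re := by
  rw [Fintype.sum_prod_type]
  refine Finset.sum_congr rfl fun e _ => ?_
  rw [Matrix.trace, Complex.re_sum]
  rfl

-- Each pattern and error position selects a diagonal block of `X`, whose weight is at most its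
-- trace; the blocks are disjoint.
omit [∀ k, DecidableEq (Er k)] in
theorem integral_errTolMeas_le (hΞ : ∀ s, IsCovariantPOVM (Ξ s))
    {X : Matrix (NoisyFrames d m Er) (NoisyFrames d m Er) ℂ} (hX : X.PosSemidef) :
    ∫ U, (errTolMeas Ξ U X).re ∂haarSU d ≤ X.trace.re := by
  simp only [re_errTolMeas]
  calc _ ≤ ∑ s, ∑ e : (∀ k : {k // k ∉ s}, Er k),
        ((X.submatrix (place s e) (place s e)).trace).re :=
        integral_sum_sum_le (T := fun s : Finset (Fin sR) => ∀ k : {k // k ∉ s}, Er k)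
          (f := fun s e U =>
            (X.submatrix (place s e) (place s e) * conjMap (actFrames m _ U) (Ξ s)).trace.re)
          (fun s e => Complex.continuous_re.comp (continuous_const.matrix_mul
            (continuous_conjMap (continuous_actFrames _) continuous_const)).matrix_trace)
          fun s e => integral_trace_mul_conjMap_le (hΞ s) (hX.submatrix _)
    _ = ∑ s, ∑ x, (X (placePair s x) (placePair s x)).re :=
        Finset.sum_congr rfl fun s _ => sum_trace_submatrix_place s X
    _ ≤ ∑ y, (X y y).re := sum_placePair_le (f := fun y => (X y y).re) fun y =>
         (Complex.le_def.mp hX.diag_nonneg).1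
    _ = X.trace.re := by rw [Matrix.trace, Complex.re_sum]; rfl

end Measurement

/-! ### The covariant code under covariant noise -/

section CovariantCode

variable {d nP m sR : ℕ} {Er : Fin sR → Type*} [∀ k, Fintype (Er k)] [∀ k, DecidableEq (Er k)]

theorem decCov_apply (D : SuperOp (Qudits d nP) (Logical d))
    (Ξ : ∀ s : Finset (Fin sR), Matrix (Frames d m {k // k ∈ s}) (Frames d m {k // k ∈ s}) ℂ)
    (Y : Matrix (Qudits d nP) (Qudits d nP) ℂ)
    (Z : Matrix (NoisyFrames d m Er) (NoisyFrames d m Er) ℂ) :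
    decCov D Ξ (Y ⊗ₖ Z) = haarMat fun U : SU d => errTolMeas Ξ U Z •
      conjMap (U : Matrix (Fin d) (Fin d) ℂ) (D (conjMap (actQ nP U⁻¹) Y)) := by
  rw [decCov, haarMap_apply]
  · simp only [tensorFunctional_kronecker]; rfl
  · intro X
    refine continuous_conjMap continuous_coe_SU (continuous_linearMap_apply (continuous_conjMap
      ((continuous_actQ nP).comp continuous_inv) ?_) D)
    exact continuous_matrix fun i j => continuous_errTolMeas Ξ _

/-- Substitute `V * U` for `U` in the Haar integral and use covariance of the measurement. -/
theorem decCov_conjMap (W : ∀ k, SU d →* Matrix.unitaryGroup (Er k) ℂ)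
    (D : SuperOp (Qudits d nP) (Logical d))
    (Ξ : ∀ s : Finset (Fin sR), Matrix (Frames d m {k // k ∈ s}) (Frames d m {k // k ∈ s}) ℂ)
    (V : SU d) (Y : Matrix (Qudits d nP) (Qudits d nP) ℂ)
    (Z : Matrix (NoisyFrames d m Er) (NoisyFrames d m Er) ℂ) :
    decCov D Ξ (conjMap (actQ nP V ⊗ₖ actNoisy (m := m) W V) (Y ⊗ₖ Z))
      = conjMap (V : Matrix (Fin d) (Fin d) ℂ) (decCov D Ξ (Y ⊗ₖ Z)) := by
  rw [conjMap_kronecker, decCov_apply, decCov_apply, map_haarMat]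
  · rw [← haarMat_mul_left _ V]
    refine congrArg haarMat (funext fun U => ?_)
    have h : conjMap (actQ nP (V * U)⁻¹) (conjMap (actQ nP V) Y) = conjMap (actQ nP U⁻¹) Y := by
      rw [← LinearMap.comp_apply, conjMap_comp, ← actQ_mul, _root_.mul_inv_rev, inv_mul_cancel_right]
    rw [errTolMeas_conjMap_actNoisy, map_smul, h, Submonoid.coe_mul, ← conjMap_comp]
    rfl
  · exact (continuous_errTolMeas Ξ Z).smul (continuous_conjMap continuous_coe_SU
      (continuous_linearMap_apply (continuous_conjMap
        ((continuous_actQ nP).comp continuous_inv) continuous_const) D))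

/-- On a product input the measurement of the frames only supplies the weight of each rotation of
the decoder. -/
theorem decCov_eq_rotatedCode (D : SuperOp (Qudits d nP) (Logical d))
    (N : SuperOp (Logical d) (Qudits d nP))
    (Ξ : ∀ s : Finset (Fin sR), Matrix (Frames d m {k // k ∈ s}) (Frames d m {k // k ∈ s}) ℂ)
    {q : SU d → ℝ} (hq : Continuous q) {Z : Matrix (NoisyFrames d m Er) (NoisyFrames d m Er) ℂ}
    (hZ : ∀ U, errTolMeas Ξ U Z = q U) (X : Matrix (Fin d) (Fin d) ℂ) :
    decCov D Ξ (N X ⊗ₖ Z) = rotatedCode q D N X := by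
  rw [decCov_apply, rotatedCode, haarMap_apply (continuous_rotatedCode_integrand hq D N)]
  simp only [hZ]
  rfl

theorem encCov_apply (E : SuperOp (Logical d) (Qudits d nP))
    (Ψ : Matrix (Frames d m (Fin sR)) (Frames d m (Fin sR)) ℂ) (X : Matrix (Fin d) (Fin d) ℂ) :
    encCov E Ψ X = (haarMat fun U : SU d =>
      conjMap (actQ nP U ⊗ₖ actFrames m (Fin sR) U)
        (E (conjMap ((U⁻¹ : SU d) : Matrix (Fin d) (Fin d) ℂ) X) ⊗ₖ Ψ)) ∧
    Continuous fun U : SU d => conjMap (actQ nP U ⊗ₖ actFrames m (Fin sR) U)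
        (E (conjMap ((U⁻¹ : SU d) : Matrix (Fin d) (Fin d) ℂ) X) ⊗ₖ Ψ) := by
  have hcont : ∀ X : Matrix (Fin d) (Fin d) ℂ, Continuous fun U : SU d =>
      conjMap (actQ nP U ⊗ₖ actFrames m (Fin sR) U)
        (E (conjMap ((U⁻¹ : SU d) : Matrix (Fin d) (Fin d) ℂ) X) ⊗ₖ Ψ) := fun X => by
    refine continuous_conjMap ?_ ?_
    · exact continuous_matrix fun a b => ((continuous_actQ nP).matrix_elem a.1 b.1).mul
        ((continuous_actFrames (Fin sR)).matrix_elem a.2 b.2)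
    · exact continuous_matrix fun a b => ((continuous_linearMap_apply
        (continuous_conjMap continuous_coe_inv_SU continuous_const) E).matrix_elem a.1 b.1).mul
        continuous_const
  refine ⟨?_, hcont X⟩
  have h : ∀ (U : SU d) (X : Matrix (Fin d) (Fin d) ℂ), appendState
      (conjMap (actQ nP U) ∘ₗ E ∘ₗ conjMap ((U⁻¹ : SU d) : Matrix (Fin d) (Fin d) ℂ))
      (conjMap (actFrames m (Fin sR) U) Ψ) X = conjMap (actQ nP U ⊗ₖ actFrames m (Fin sR) U)
        (E (conjMap ((U⁻¹ : SU d) : Matrix (Fin d) (Fin d) ℂ) X) ⊗ₖ Ψ) := fun U X => by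
    rw [conjMap_kronecker]; rfl
  rw [encCov, haarMap_apply]
  · simp only [h]
  · simp only [h]; exact hcont

/-- The reduction to a twirl: `V` and the encoder's `U` merge to `V * U`, which leaves the decoder
on the left while `U⁻¹` stays on the input. -/
theorem decCov_comp_noise_comp_encCov (W : ∀ k, SU d →* Matrix.unitaryGroup (Er k) ℂ)
    (E : SuperOp (Logical d) (Qudits d nP)) (D : SuperOp (Qudits d nP) (Logical d))
    (Ψ : Matrix (Frames d m (Fin sR)) (Frames d m (Fin sR)) ℂ)
    (Ξ : ∀ s : Finset (Fin sR), Matrix (Frames d m {k // k ∈ s}) (Frames d m {k // k ∈ s}) ℂ)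
    {J : Type*} [Fintype J] (p : J → ℝ)
    (CP : J → SuperOp (Qudits d nP) (Qudits d nP))
    (CR : J → SuperOp (Frames d m (Fin sR)) (NoisyFrames d m Er))
    (hC : IsCovariantNoise W (noise p CP CR)) {q : J → SU d → ℝ} (hq : ∀ j, Continuous (q j))
    (hqM : ∀ j U, errTolMeas Ξ U (CR j Ψ) = q j U) (V : SU d) :
    decCov D Ξ ∘ₗ noise p CP CR ∘ₗ conjMap (actQ nP V ⊗ₖ actFrames m (Fin sR) V) ∘ₗ encCov E Ψ
      = conjMap (V : Matrix (Fin d) (Fin d) ℂ)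
        ∘ₗ ∑ j, (p j : ℂ) • twirl (rotatedCode (q j) D (CP j ∘ₗ E)) := by
  ext1 X
  obtain ⟨h1, hcont⟩ := encCov_apply E Ψ X
  set S : SuperOp (Fin d) (Fin d) := ∑ j, (p j : ℂ) • rotatedCode (q j) D (CP j ∘ₗ E) with hS
  -- Covariance is applied to the whole mixture; only afterwards is the noise split into product
  -- terms acting on `E Y ⊗ Ψ`.
  have h2 : ∀ (g : SU d) (Y : Matrix (Fin d) (Fin d) ℂ), decCov D Ξ (noise p CP CR
      (conjMap (actQ nP g ⊗ₖ actFrames m (Fin sR) g) (E Y ⊗ₖ Ψ)))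
      = conjMap (g : Matrix (Fin d) (Fin d) ℂ) (S Y) := by
    intro g Y
    have := LinearMap.congr_fun (hC g) (E Y ⊗ₖ Ψ)
    rw [LinearMap.comp_apply, LinearMap.comp_apply] at this
    rw [this]
    simp only [noise, hS, LinearMap.sum_apply, LinearMap.smul_apply, map_sum, map_smul,
      tensorMap_kronecker, decCov_conjMap]
    refine Finset.sum_congr rfl fun j _ => ?_
    rw [← decCov_eq_rotatedCode D (CP j ∘ₗ E) Ξ (hq j) (hqM j)]
    rfl
  have h3 : ∑ j, (p j : ℂ) • twirl (rotatedCode (q j) D (CP j ∘ₗ E)) = twirl S := by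
    ext1 Y
    rw [twirl, haarMap_apply (continuous_twirl_integrand S), LinearMap.sum_apply]
    simp only [hS, LinearMap.comp_apply, LinearMap.sum_apply, map_sum, LinearMap.smul_apply,
      map_smul]
    have hc : ∀ j, Continuous fun U : SU d => (p j : ℂ) • conjMap (U : Matrix (Fin d) (Fin d) ℂ)
        (rotatedCode (q j) D (CP j ∘ₗ E) (conjMap ((U⁻¹ : SU d) : Matrix (Fin d) (Fin d) ℂ) Y)) :=
      fun j => (continuous_twirl_integrand (rotatedCode (q j) D (CP j ∘ₗ E)) Y).const_smul (p j : ℂ)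
    rw [haarMat_sum _ fun j _ => hc j]
    refine Finset.sum_congr rfl fun j _ => ?_
    rw [haarMat_smul, twirl, haarMap_apply (continuous_twirl_integrand _)]
    rfl
  rw [h3]
  simp only [LinearMap.comp_apply]
  rw [h1, map_haarMat hcont]
  have hcont2 := continuous_linearMap_apply hcont
    (conjMap (actQ nP V ⊗ₖ actFrames m (Fin sR) V))
  rw [map_haarMat hcont2, map_haarMat (continuous_linearMap_apply hcont2 _), twirl,
    haarMap_apply (continuous_twirl_integrand S), map_haarMat (continuous_twirl_integrand S X)]
  refine congrArg haarMat (funext fun U => ?_)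
  rw [← LinearMap.comp_apply (conjMap _) (conjMap _), conjMap_comp, ← Matrix.mul_kronecker_mul,
    ← actQ_mul, ← actFrames_mul, h2, Submonoid.coe_mul, ← conjMap_comp]
  rfl

end CovariantCode

/-! ### The error of the covariant code -/

section ErrorBound

theorem IsCP.posSemidef {ι κ : Type*} [Fintype ι] {Φ : SuperOp ι κ} (h : IsCP Φ)
    {X : Matrix ι ι ℂ} (hX : X.PosSemidef) : (Φ X).PosSemidef := by
  have h1 := h 1 _ (hX.kronecker (Matrix.PosSemidef.one (n := Fin 1) (R := ℂ)))
  rw [tensorMap_kronecker] at h1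
  convert h1.submatrix fun i => (i, 0)
  ext i j
  simp

theorem IsCP.entFid_eq_re {d : ℕ} {Φ : SuperOp (Fin d) (Fin d)} (h : IsCP Φ) :
    entFid Φ = ((entFid Φ).re : ℂ) := by
  obtain ⟨r, K, rfl⟩ := h.exists_kraus
  rw [entFid_sum_conjMap, Complex.ofReal_re]

variable {d : ℕ}

theorem isCP_rotatedCode {n : ℕ} {q : SU d → ℝ} (hq : Continuous q) (hq0 : ∀ U, 0 ≤ q U)
    {D : SuperOp (Qudits d n) (Fin d)} {N : SuperOp (Fin d) (Qudits d n)} (hD : IsCP D)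
    (hN : IsCP N) : IsCP (rotatedCode q D N) := fun k X hX => by
  rw [rotatedCode, tensorMap_haarMap (continuous_rotatedCode_integrand hq D N)]
  refine haarMat_posSemidef
    (continuous_tensorMap_id (continuous_rotatedCode_integrand hq D N) X) fun U => ?_
  rw [tensorMap_smul_id]
  exact (((isCP_conjMap _).comp (hD.comp ((isCP_conjMap _).comp hN))) k X hX).smul
    (Complex.zero_le_real.mpr (hq0 U))

theorem trace_rotatedCode {n : ℕ} {q : SU d → ℝ} (hq : Continuous q)
    {D : SuperOp (Qudits d n) (Fin d)} {N : SuperOp (Fin d) (Qudits d n)} (hD : IsChannel D)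
    (hN : IsChannel N) (X : Matrix (Fin d) (Fin d) ℂ) :
    (rotatedCode q D N X).trace = ((∫ U, q U ∂haarSU d : ℝ) : ℂ) * X.trace := by
  rw [rotatedCode, haarMap_apply (continuous_rotatedCode_integrand hq D N),
    trace_haarMat (continuous_rotatedCode_integrand hq D N X)]
  have h : ∀ U : SU d, (((q U : ℂ) • (conjMap (U : Matrix (Fin d) (Fin d) ℂ) ∘ₗ D
      ∘ₗ conjMap (actQ n U⁻¹) ∘ₗ N)) X).trace = (q U : ℂ) * X.trace := fun U => by
    rw [LinearMap.smul_apply, Matrix.trace_smul, LinearMap.comp_apply,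
      conjMap_trace (SU_conjTranspose_mul U), LinearMap.comp_apply, hD.2, LinearMap.comp_apply,
      conjMap_trace (actQ_conjTranspose_mul n _), hN.2, smul_eq_mul]
  simp only [h]
  rw [integral_mul_const]
  erw [integral_ofReal]
  rfl

/-- The positive remainder of the twirl has trace `Q - f` on a state. -/
theorem entFid_le_of_trace (hd : d ≠ 0) {Φ : SuperOp (Fin d) (Fin d)} (hΦ : IsCP Φ) {Q : ℝ}
    (hQ : ∀ X, (Φ X).trace = (Q : ℂ) * X.trace) : (entFid Φ).re ≤ Q := by
  have hst := isState_vecMulVec (maxEnt_norm hd)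
  have h := (Complex.le_def.mp (posSemidef_twirl_sub hΦ hst.1).trace_nonneg).1
  rw [Matrix.trace_sub, trace_tensorMap_twirl hQ, Matrix.trace_smul, hst.2, smul_eq_mul, mul_one,
    mul_one, Complex.sub_re, Complex.ofReal_re, Complex.zero_re] at h
  linarith

/-- A convex combination of twirled maps followed by a unitary is close to that unitary, with error
the average entanglement infidelity. -/
theorem epsWc_conjMap_comp_twirl_le (hd : d ≠ 0) (V : SU d) {J : Type*} [Fintype J] {p : J → ℝ}
    (hp : ∀ j, 0 ≤ p j) (hp1 : ∑ j, p j = 1) {Φ : J → SuperOp (Fin d) (Fin d)}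
    (hΦ : ∀ j, IsCP (Φ j)) {Q : J → ℝ} (hQ1 : ∀ j, Q j ≤ 1)
    (hQ : ∀ j X, (Φ j X).trace = (Q j : ℂ) * X.trace) :
    epsWc (conjMap (V : Matrix (Fin d) (Fin d) ℂ) ∘ₗ ∑ j, (p j : ℂ) • twirl (Φ j))
      (conjMap (V : Matrix (Fin d) (Fin d) ℂ)) ≤ ∑ j, p j * (1 - (entFid (Φ j)).re) := by
  have hf : ∀ j, 0 ≤ 1 - (entFid (Φ j)).re := fun j =>
    sub_nonneg.mpr ((entFid_le_of_trace hd (hΦ j) (hQ j)).trans (hQ1 j))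
  refine epsWc_le (Finset.sum_nonneg fun j _ => mul_nonneg (hp j) (hf j)) fun k ρ hρ => ?_
  -- `A` is the remainder of the twirls, of trace `∑ pⱼ (Qⱼ - fⱼ)`, and `B` is the missing weight of
  -- the identity, of trace `∑ pⱼ (1 - fⱼ)`; both are positive.
  set A : Matrix (Fin d × Fin k) (Fin d × Fin k) ℂ := ∑ j, (p j : ℂ) •
    (tensorMap (twirl (Φ j)) (LinearMap.id : SuperOp (Fin k) (Fin k)) ρ - entFid (Φ j) • ρ) with hA
  set B : Matrix (Fin d × Fin k) (Fin d × Fin k) ℂ :=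
    ((∑ j, p j * (1 - (entFid (Φ j)).re) : ℝ) : ℂ) • ρ with hB
  have hApos : A.PosSemidef := Matrix.posSemidef_sum _ fun j _ =>
    (posSemidef_twirl_sub (hΦ j) hρ.1).smul (Complex.zero_le_real.mpr (hp j))
  have hBpos : B.PosSemidef := hρ.1.smul (Complex.zero_le_real.mpr
    (Finset.sum_nonneg fun j _ => mul_nonneg (hp j) (hf j)))
  have hAB : tensorMap (∑ j, (p j : ℂ) • twirl (Φ j)) (LinearMap.id : SuperOp (Fin k) (Fin k)) ρ - ρ
      = A - B := by
    have hB' : B = ρ - ∑ j, (p j : ℂ) • entFid (Φ j) • ρ := by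
      have h1 : ρ = ∑ j, (p j : ℂ) • ρ := by
        rw [← Finset.sum_smul, ← Complex.ofReal_sum, hp1, Complex.ofReal_one, one_smul]
      conv_rhs => enter [1]; rw [h1]
      rw [hB, ← Finset.sum_sub_distrib, Complex.ofReal_sum, Finset.sum_smul]
      refine Finset.sum_congr rfl fun j _ => ?_
      rw [(hΦ j).entFid_eq_re, Complex.ofReal_re, smul_smul, ← sub_smul]
      congr 1
      push_cast
      ring
    rw [hB', hA, tensorMap_sum_id]
    simp only [tensorMap_smul_id, smul_sub, Finset.sum_sub_distrib]
    abel
  have hVV : ((V : Matrix (Fin d) (Fin d) ℂ) ⊗ₖ (1 : Matrix (Fin k) (Fin k) ℂ))ᴴ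
      * ((V : Matrix (Fin d) (Fin d) ℂ) ⊗ₖ (1 : Matrix (Fin k) (Fin k) ℂ)) = 1 := by
    rw [conjTranspose_kronecker, ← Matrix.mul_kronecker_mul, SU_conjTranspose_mul,
      conjTranspose_one, Matrix.one_mul, Matrix.one_kronecker_one]
  rw [tensorMap_comp_id, tensorMap_conjMap_id, tensorMap_conjMap_id, ← map_sub, hAB, map_sub]
  refine (traceNorm_sub_le (conjMap_posSemidef _ hApos) (conjMap_posSemidef _ hBpos)).trans ?_
  rw [conjMap_trace hVV, conjMap_trace hVV, hA, hB, Matrix.trace_sum, Matrix.trace_smul, hρ.2,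
    smul_eq_mul, mul_one, Complex.ofReal_re, Complex.re_sum, two_mul]
  refine add_le_add (Finset.sum_le_sum fun j _ => ?_) le_rfl
  rw [Matrix.trace_smul, Matrix.trace_sub, trace_tensorMap_twirl (hQ j), Matrix.trace_smul, hρ.2,
    smul_eq_mul, smul_eq_mul, mul_one, mul_one, Complex.re_ofReal_mul, Complex.sub_re,
    Complex.ofReal_re]
  have := hQ1 j
  exact mul_le_mul_of_nonneg_left (by linarith) (hp j)

theorem epsWc_nonneg {ι κ : Type*} [Fintype ι] [Fintype κ] [DecidableEq κ] (Φ Θ : SuperOp ι κ) :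
    0 ≤ epsWc Φ Θ :=
  mul_nonneg (by norm_num)
    (Real.sSup_nonneg (by rintro _ ⟨k, ρ, -, rfl⟩; exact traceNorm_nonneg _))

end ErrorBound

end

end CovCode

/-! ### Assembly of the bound -/

theorem lemma1 {d nP m sR : ℕ} {Er : Fin sR → Type*}
    [∀ k, Fintype (Er k)] [∀ k, DecidableEq (Er k)]
    (W : ∀ k, CovCode.SU d →* Matrix.unitaryGroup (Er k) ℂ)
    (E : CovCode.SuperOp (CovCode.Logical d) (CovCode.Qudits d nP))
    (D : CovCode.SuperOp (CovCode.Qudits d nP) (CovCode.Logical d))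
    (hE : CovCode.IsChannel E) (hD : CovCode.IsChannel D)
    (Ψ : Matrix (CovCode.Frames d m (Fin sR)) (CovCode.Frames d m (Fin sR)) ℂ)
    (hΨ : CovCode.IsState Ψ)
    (Ξ : ∀ s : Finset (Fin sR), Matrix (CovCode.Frames d m {k // k ∈ s})
      (CovCode.Frames d m {k // k ∈ s}) ℂ)
    (hΞ : ∀ s, CovCode.IsCovariantPOVM (Ξ s))
    {J : Type*} [Fintype J] (p : J → ℝ) (hp : ∀ j, 0 ≤ p j) (hp1 : ∑ j, p j = 1)
    (CP : J → CovCode.SuperOp (CovCode.Qudits d nP) (CovCode.Qudits d nP))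
    (CR : J → CovCode.SuperOp (CovCode.Frames d m (Fin sR)) (CovCode.NoisyFrames d m Er))
    (hCP : ∀ j, CovCode.IsChannel (CP j)) (hCR : ∀ j, CovCode.IsChannel (CR j))
    (hC : CovCode.IsCovariantNoise W (CovCode.noise p CP CR)) :
    CovCode.epsCov E D Ψ Ξ (CovCode.noise p CP CR)
      ≤ 9 * d * ∑ j, p j * CovCode.epsTerm E D Ψ Ξ (CP j) (CR j) := by
  classical
  open CovCode in
  refine ciSup_le fun V => ?_
  rcases Nat.eq_zero_or_pos d with rfl | hd
  · rw [Nat.cast_zero, mul_zero, zero_mul]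
    -- For `d = 0` the right side is 0, and there are no states since every trace is an empty sum.
    refine epsWc_le le_rfl fun k ρ hρ => ?_
    have := hρ.2
    rw [Matrix.trace, Finset.univ_eq_empty, Finset.sum_empty] at this
    exact absurd this zero_ne_one
  let q : J → SU d → ℝ := fun j U => (errTolMeas Ξ U (CR j Ψ)).re
  have hZ : ∀ j, (CR j Ψ).PosSemidef := fun j => (hCR j).isCP.posSemidef hΨ.1
  have hq : ∀ j, Continuous (q j) := fun j =>
    Complex.continuous_re.comp (continuous_errTolMeas Ξ _)
  have hM : ∀ j U, 0 ≤ errTolMeas Ξ U (CR j Ψ) := fun j U =>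
    errTolMeas_nonneg (fun s => (hΞ s).1) (hZ j) U
  have hqM : ∀ j U, errTolMeas Ξ U (CR j Ψ) = q j U := fun j U =>
    Complex.ext rfl (by simpa using (Complex.le_def.mp (hM j U)).2.symm)
  have hq0 : ∀ j U, 0 ≤ q j U := fun j U => (Complex.le_def.mp (hM j U)).1
  have hq1 : ∀ j, ∫ U, q j U ∂haarSU d ≤ 1 := fun j => by
    refine (integral_errTolMeas_le hΞ (hZ j)).trans_eq ?_
    rw [(hCR j).2, hΨ.2, Complex.one_re]
  have hN : ∀ j, IsChannel (CP j ∘ₗ E) := fun j => (hCP j).comp hE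
  let f : J → ℝ := fun j => (entFid (rotatedCode (q j) D (CP j ∘ₗ E))).re
  have hcp : ∀ j, IsCP (rotatedCode (q j) D (CP j ∘ₗ E)) := fun j =>
    isCP_rotatedCode (hq j) (hq0 j) hD.isCP (hN j).isCP
  have htr := fun j => trace_rotatedCode (hq j) hD (hN j)
  have hf0 : ∀ j, 0 ≤ (f j) := fun j => by
    obtain ⟨r, K, hK⟩ := (hcp j).exists_kraus
    simp only [f]
    rw [hK, entFid_sum_conjMap, Complex.ofReal_re]
    positivity
  have hterm : ∀ j, 1 - f j ≤ 6 * epsTerm E D Ψ Ξ (CP j) (CR j)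
      ∧ 0 ≤ epsTerm E D Ψ Ξ (CP j) (CR j) := by
    intro j
    have hdens : outcomeDensity Ψ Ξ (CR j) = fun U => (q j U : ℂ) := funext (hqM j)
    have hmain := one_sub_entFid_rotatedCode_le hd.ne' (hq j) (hq0 j) (hq1 j) hD (hN j)
    have he := epsWc_nonneg (D ∘ₗ CP j ∘ₗ E) LinearMap.id
    rw [epsTerm, hdens]
    split_ifs
    · have h1 := le_max_left (epsWc (D ∘ₗ CP j ∘ₗ E) LinearMap.id)
        (1 - frameFidelity nP fun U => (q j U : ℂ))
      have h2 := le_max_right (epsWc (D ∘ₗ CP j ∘ₗ E) LinearMap.id)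
        (1 - frameFidelity nP fun U => (q j U : ℂ))
      exact ⟨by simp only [f]; linarith, he.trans h1⟩
    -- Here `εⱼ = 1`, and `fⱼ ≥ 0` suffices.
    · exact ⟨by linarith [hf0 j], zero_le_one⟩
  rw [decCov_comp_noise_comp_encCov W E D Ψ Ξ p CP CR hC hq hqM V]
  refine (epsWc_conjMap_comp_twirl_le hd.ne' V hp hp1 hcp hq1 htr).trans ?_
  have hsum : 0 ≤ ∑ j, p j * epsTerm E D Ψ Ξ (CP j) (CR j) :=
    Finset.sum_nonneg fun j _ => mul_nonneg (hp j) (hterm j).2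
  have hd1 : (1 : ℝ) ≤ d := by exact_mod_cast hd
  calc ∑ j, p j * (1 - f j) ≤ ∑ j, p j * (6 * epsTerm E D Ψ Ξ (CP j) (CR j)) :=
        Finset.sum_le_sum fun j _ => mul_le_mul_of_nonneg_left (hterm j).1 (hp j)
    _ = 6 * ∑ j, p j * epsTerm E D Ψ Ξ (CP j) (CR j) := by
        rw [Finset.mul_sum]
        exact Finset.sum_congr rfl fun j _ => by ring
    -- The only place where `9 d` enters: `6 ≤ 9 d`.
    _ ≤ _ := mul_le_mul_of_nonneg_right (by linarith) hsum
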